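/- **Theorem (user scaling law for SVD-based opportunistic interference alignment).** Let $K,M,L,S$ be positive integers with $S\le M$ and $L<(K-1)S+1$. Consider a $K$-cell uplink in which every cell has one base station (BS) with $M$ antennas and $N$ users with $L$ antennas each. The channel from user $j$ of cell $i$ to BS $k$ is $H_k^{[i,j]}\in\mathbb C^{M\times L}$, and all entries of all these matrices are i.i.d. circularly symmetric complex Gaussian with mean zero and a fixed positive variance. Independently of the channels, every BS $k$ fixes a matrix $Q_k\in\mathbb C^{M\times(M-S)}$ of full rank and a matrix $U_k\in\mathbb C^{M\times S}$ whose columns form an orthonormal basis of the null space of $Q_k^H$. SVD-based scheme. Let $G^{[i,j]}\in\mathbb C^{(K-1)S\times L}$ be the matrix obtained by stacking the blocks $U_k^HH_k^{[i,j]}$, $k\ne i$, with singular value decomposition $G^{[i,j]}=\Omega\,\mathrm{diag}(\sigma_1,\dots,\sigma_L)V^H$, $\sigma_1\ge\dots\ge\sigma_L\ge 0$. User $j$ of cell $i$ uses as unit weight vector $w^{[i,j]}$ the last column of $V$, and reports the metric $\eta^{[i,j]}=\sigma_L^2$. In every cell the BS selects $S$ users with the smallest metrics (ties broken in an arbitrary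 way); write $[i,1],\dots,[i,S]$ for the users selected in cell $i$. BS $i$ applies $U_i^H$ and the zero-forcing equalizer $F_i=[f_{i,1},\dots,f_{i,S}]$ with $F_i^H=\big[U_i^HH_i^{[i,1]}w^{[i,1]},\dots,U_i^HH_i^{[i,S]}w^{[i,S]}\big]^{-1}$, so that the rate of the $j$-th selected user of cell $i$ is $$R^{[i,j]}=\log\Big(1+\frac{\mathrm{SNR}}{\|f_{i,j}\|^2+I_{i,j}}\Big),\qquad I_{i,j}=\sum_{k\ne i}\sum_{m=1}^S\big|f_{i,j}^HU_i^HH_i^{[k,m]}w^{[k,m]}\big|^2\,\mathrm{SNR}.$$ If $N=N(\mathrm{SNR})$ satisfies $N=\omega\big(\mathrm{SNR}^{(K-1)S-L+1}\big)$, that is, $\mathrm{SNR}^{(K-1)S-L+1}/N\to0$ as $\mathrm{SNR}\to\infty$, then the scheme achieves $\mathrm{DoF}\ge KS$ with high probability: for every $\delta>0$, $$\lim_{\mathrm{SNR}\to\infty}\Pr\Big\{\frac{\sum_{i=1}^K\sum_{j=1}^SR^{[i,j]}}{\log\mathrm{SNR}}\ge KS-\delta\Big\}=1 .$$ -/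

import Mathlib

open MeasureTheory ProbabilityTheory Filter Topology Asymptotics
open scoped Matrix NNReal

namespace OIA

noncomputable section

/-- The circularly symmetric complex Gaussian law whose real and imaginary parts are
independent real Gaussians with mean `0` and variance `v` each. -/
def complexGaussian (v : ℝ≥0) : Measure ℂ :=
  ((gaussianReal 0 v).prod (gaussianReal 0 v)).map (fun p : ℝ × ℝ => (⟨p.1, p.2⟩ : ℂ))

/-- `Q` is a full-rank interference basis and the columns of `U` are an orthonormal basis of
the null space of `Qᴴ`, that is, of the orthogonal complement of the column span of `Q`. -/
structure IsReferenceBasis {M S : ℕ} (Q : Matrix (Fin M) (Fin (M - S)) ℂ)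
    (U : Matrix (Fin M) (Fin S) ℂ) : Prop where
  fullRank : LinearIndependent ℂ Q.col
  orthonormal : Uᴴ * U = 1
  orthogonal : Uᴴ * Q = 0

/-- A way of computing a singular value decomposition `G = Ω Σ Vᴴ` of every matrix `G` with
`L` columns: `Ω` and `V` have `L` orthonormal columns, `Σ` is diagonal and the singular
values are nonnegative and listed in decreasing order. -/
structure SVDRule (R : Type) [Fintype R] (L : ℕ) [NeZero L] where
  left : Matrix R (Fin L) ℂ → Matrix R (Fin L) ℂ
  sing : Matrix R (Fin L) ℂ → Fin L → ℝ
  right : Matrix R (Fin L) ℂ → Matrix (Fin L) (Fin L) ℂ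
  factor : ∀ G, G = left G * Matrix.diagonal (fun l => (sing G l : ℂ)) * (right G)ᴴ
  left_orthonormal : ∀ G, (left G)ᴴ * left G = 1
  right_orthonormal : ∀ G, (right G)ᴴ * right G = 1
  sing_nonneg : ∀ G l, 0 ≤ sing G l
  sing_antitone : ∀ G, Antitone (sing G)
  measurable_last : ∀ l, Measurable (fun G : R → Fin L → ℂ => right (Matrix.of G) l ⊤)

/-- A rule by which a base station selects `S` out of `n` users from their reported metrics:
the selected users are distinct, and none of them has a larger metric than a user that is not
selected. Ties are broken in an arbitrary way. (Nothing is required if there are fewer than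
`S` users.) -/
structure SelectionRule (S : ℕ) where
  pick : (n : ℕ) → (Fin n → ℝ) → Fin S → ℕ
  measurable_pick : ∀ n, Measurable (pick n)
  pick_lt : ∀ n η s, S ≤ n → pick n η s < n
  pick_injective : ∀ n η, S ≤ n → Function.Injective (pick n η)
  pick_smallest : ∀ n η, S ≤ n → ∀ a b : Fin n,
    (∃ s, pick n η s = a) → (∀ s, pick n η s ≠ b) → η a ≤ η b

section Realization

/-! One realization of the channels; `H k i j` is the channel from user `j` of cell `i` to
base station `k`. -/

variable {K M L S : ℕ}

/-- The stacked cross-link channel matrix of user `j` in cell `i`; its `(K-1)S` rows are the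
rows of the matrices `U_kᴴ H_k^{[i,j]}`, `k ≠ i`. -/
def crossLink (U : Fin K → Matrix (Fin M) (Fin S) ℂ)
    (H : Fin K → Fin K → ℕ → Matrix (Fin M) (Fin L) ℂ) (i : Fin K) (j : ℕ) :
    Matrix ({k : Fin K // k ≠ i} × Fin S) (Fin L) ℂ :=
  Matrix.of fun r l => ((U r.1)ᴴ * H r.1 i j) r.2 l

/-- The weight vector of user `j` in cell `i`: the last right singular vector of its
cross-link matrix. -/
def weight [NeZero L] (svd : (i : Fin K) → ℕ → SVDRule ({k : Fin K // k ≠ i} × Fin S) L)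
    (U : Fin K → Matrix (Fin M) (Fin S) ℂ)
    (H : Fin K → Fin K → ℕ → Matrix (Fin M) (Fin L) ℂ) (i : Fin K) (j : ℕ) : Fin L → ℂ :=
  fun l => (svd i j).right (crossLink U H i j) l ⊤

/-- The scheduling metric of user `j` in cell `i`: the square of the smallest singular value
of its cross-link matrix. -/
def metric [NeZero L] (svd : (i : Fin K) → ℕ → SVDRule ({k : Fin K // k ≠ i} × Fin S) L)
    (U : Fin K → Matrix (Fin M) (Fin S) ℂ)
    (H : Fin K → Fin K → ℕ → Matrix (Fin M) (Fin L) ℂ) (i : Fin K) (j : ℕ) : ℝ :=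
  (svd i j).sing (crossLink U H i j) ⊤ ^ 2

/-- The users selected in each cell when every cell has users `0, …, n - 1`. -/
def selected [NeZero L] (svd : (i : Fin K) → ℕ → SVDRule ({k : Fin K // k ≠ i} × Fin S) L)
    (sel : Fin K → SelectionRule S) (U : Fin K → Matrix (Fin M) (Fin S) ℂ)
    (H : Fin K → Fin K → ℕ → Matrix (Fin M) (Fin L) ℂ) (n : ℕ) (i : Fin K) : Fin S → ℕ :=
  (sel i).pick n (fun j : Fin n => metric svd U H i j)

/-- The `S × S` matrix with columns `U_iᴴ H_i^{[k,m]} w^{[k,m]}`, where `m` runs through the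
scheduled users `π k` of cell `k`. -/
def effChannel (U : Fin K → Matrix (Fin M) (Fin S) ℂ)
    (H : Fin K → Fin K → ℕ → Matrix (Fin M) (Fin L) ℂ) (w : Fin K → ℕ → Fin L → ℂ)
    (π : Fin K → Fin S → ℕ) (i k : Fin K) : Matrix (Fin S) (Fin S) ℂ :=
  Matrix.of fun a m => ((U i)ᴴ *ᵥ (H i k (π k m) *ᵥ w k (π k m))) a

/-- The zero-forcing equalizer of base station `i`; its columns are the vectors `f_{i,s}`. -/
def zfEqualizer (U : Fin K → Matrix (Fin M) (Fin S) ℂ)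
    (H : Fin K → Fin K → ℕ → Matrix (Fin M) (Fin L) ℂ) (w : Fin K → ℕ → Fin L → ℂ)
    (π : Fin K → Fin S → ℕ) (i : Fin K) : Matrix (Fin S) (Fin S) ℂ :=
  ((effChannel U H w π i i)⁻¹)ᴴ

/-- The inter-cell interference power in the `s`-th stream of base station `i`. -/
def interference (U : Fin K → Matrix (Fin M) (Fin S) ℂ)
    (H : Fin K → Fin K → ℕ → Matrix (Fin M) (Fin L) ℂ) (w : Fin K → ℕ → Fin L → ℂ)
    (π : Fin K → Fin S → ℕ) (snr : ℝ) (i : Fin K) (s : Fin S) : ℝ :=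
  ∑ k ∈ Finset.univ.erase i, ∑ m : Fin S,
    ‖star ((zfEqualizer U H w π i).col s) ⬝ᵥ (effChannel U H w π i k).col m‖ ^ 2 * snr

/-- The achievable rate `log (1 + SNR / (‖f_{i,s}‖² + I_{i,s}))` of the `s`-th scheduled user
of cell `i`. (If the zero-forcing equalizer does not exist, the value of this expression is
`0`.) -/
def rate (U : Fin K → Matrix (Fin M) (Fin S) ℂ)
    (H : Fin K → Fin K → ℕ → Matrix (Fin M) (Fin L) ℂ) (w : Fin K → ℕ → Fin L → ℂ)
    (π : Fin K → Fin S → ℕ) (snr : ℝ) (i : Fin K) (s : Fin S) : ℝ :=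
  Real.log (1 + snr /
    (∑ a, ‖zfEqualizer U H w π i a s‖ ^ 2 + interference U H w π snr i s))

/-- The sum-rate of the SVD-based scheme at a given SNR with `n` users in each cell. -/
def sumRate [NeZero L] (svd : (i : Fin K) → ℕ → SVDRule ({k : Fin K // k ≠ i} × Fin S) L)
    (sel : Fin K → SelectionRule S) (U : Fin K → Matrix (Fin M) (Fin S) ℂ)
    (H : Fin K → Fin K → ℕ → Matrix (Fin M) (Fin L) ℂ) (n : ℕ) (snr : ℝ) : ℝ :=
  ∑ i : Fin K, ∑ s : Fin S,
    rate U H (weight svd U H) (selected svd sel U H n) snr i s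

end Realization

end

end OIA

/-! Two facts make every stream reach rate `log SNR - O(1)` with probability close to one.

Interference. A user's metric is the total squared norm of the interference it leaks to the other
base stations. If all scheduled metrics are at most `SNR⁻¹`, Cauchy–Schwarz bounds each interfering
term by `‖f‖²`, so the denominator of the rate is at most `‖f‖² (1 + K S)` (`le_rate`). Each
cross-link matrix is Gaussian with `(K-1)S` rows and `L` columns, and its least squared singular
value falls below `ε` with probability at least `c ε^((K-1)S-L+1)` (`exists_small_singular_value`):
solve the first `L-1` rows exactly, which leaves `(K-1)S-L+1` complex entries to be hit within
squared distance of order `ε`. Users of a cell are independent for fixed bases. Split them into `S`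
blocks of `⌊N/S⌋`; at `ε = SNR⁻¹` the growth of `N` forces every block to contain a good user with
probability tending to one, and then the `S` smallest metrics are all good
(`SelectionRule.pick_le`).

Equalizer. `‖f‖²` must stay bounded in probability uniformly in SNR, although the users are chosen
by a rule depending on `N`. Weights and selection in cell `i` depend only on channels towards base
stations `k ≠ i`, hence are independent of the direct channels `H_i^{[i,j]}`. Freezing the former
makes the equalized matrix an i.i.d. Gaussian `S × S` matrix (`measure_directChannel_le`), of a law
not depending on SNR. Such a matrix is almost surely invertible, so its inverse is tight
(`exists_inv_bound`).

Random bases independent of the channels are frozen in the same way, since all bounds are uniform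
over orthonormal bases. -/

namespace OIA

open scoped ENNReal ComplexConjugate

/-! ### Complex Gaussian vectors: unitary invariance and small-ball bounds -/

section ComplexGaussian

variable {v : ℝ≥0}

lemma measurable_complex_mk : Measurable (fun p : ℝ × ℝ => (⟨p.1, p.2⟩ : ℂ)) :=
  Complex.measurableEquivRealProd.symm.measurable

instance : IsProbabilityMeasure (complexGaussian v) :=
  Measure.isProbabilityMeasure_map measurable_complex_mk.aemeasurable

lemma integral_exp_complexGaussian (t : ℂ) :
    ∫ z, Complex.exp (((conj t * z).re : ℂ) * Complex.I) ∂complexGaussian v =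
      Complex.exp (-(v * ‖t‖ ^ 2 / 2 : ℝ)) := by
  have h1 : ∀ s : ℝ, ∫ x : ℝ, Complex.exp (s * x * Complex.I) ∂gaussianReal 0 v =
      Complex.exp (-(v * s ^ 2 / 2 : ℝ)) := by
    intro s
    rw [← charFun_apply_real, charFun_gaussianReal]
    congr 1
    push_cast
    ring
  rw [complexGaussian, integral_map measurable_complex_mk.aemeasurable]
  · have h2 : ∀ p : ℝ × ℝ, Complex.exp (((conj t * (⟨p.1, p.2⟩ : ℂ)).re : ℂ) * Complex.I) =
        Complex.exp (t.re * p.1 * Complex.I) * Complex.exp (t.im * p.2 * Complex.I) := by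
      intro p
      rw [← Complex.exp_add]
      congr 1
      simp only [Complex.mul_re, Complex.conj_re, Complex.conj_im]
      push_cast
      ring
    simp_rw [h2]
    rw [integral_prod_mul (fun x : ℝ => Complex.exp (t.re * x * Complex.I))
      (fun y : ℝ => Complex.exp (t.im * y * Complex.I)), h1, h1, ← Complex.exp_add]
    congr 1
    rw [← Complex.normSq_eq_norm_sq, Complex.normSq_apply]
    push_cast
    ring
  · exact Continuous.aestronglyMeasurable (by fun_prop)

lemma integral_exp_pi_complexGaussian {ι : Type*} [Fintype ι] (t : ι → ℂ) :
    ∫ x : ι → ℂ, Complex.exp (((∑ i, conj (t i) * x i).re : ℂ) * Complex.I)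
        ∂Measure.pi (fun _ : ι => complexGaussian v) =
      Complex.exp (-(v * (∑ i, ‖t i‖ ^ 2) / 2 : ℝ)) := by
  have h : ∀ x : ι → ℂ, Complex.exp (((∑ i, conj (t i) * x i).re : ℂ) * Complex.I) =
      ∏ i, Complex.exp (((conj (t i) * x i).re : ℂ) * Complex.I) := by
    intro x
    rw [← Complex.exp_sum, Complex.re_sum]
    push_cast
    rw [Finset.sum_mul]
  simp_rw [h]
  rw [integral_fintype_prod_eq_prod
    (fun i (z : ℂ) => Complex.exp (((conj (t i) * z).re : ℂ) * Complex.I))]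
  simp_rw [integral_exp_complexGaussian]
  rw [← Complex.exp_sum, Finset.mul_sum, Finset.sum_div]
  push_cast
  rw [Finset.sum_neg_distrib]

/-- Every real-linear functional on `ℂ^κ` is of the form `x ↦ Re ⟨t, x⟩`. -/
lemma exists_dual_eq {κ : Type*} [Fintype κ] (ℓ : StrongDual ℝ (κ → ℂ)) :
    ∃ t : κ → ℂ, ∀ x, ℓ x = (∑ k, conj (t k) * x k).re := by
  classical
  -- `Re (conj t * z) = Re t * Re z + Im t * Im z`, so `t k` records the values of `ℓ` on the real
  -- basis vectors `e_k` and `i e_k`.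
  refine ⟨fun k => ⟨ℓ (Pi.single k 1), ℓ (Pi.single k Complex.I)⟩, fun x => ?_⟩
  have hx : x = ∑ k, ((x k).re • Pi.single (M := fun _ => ℂ) k (1 : ℂ)
      + (x k).im • Pi.single (M := fun _ => ℂ) k Complex.I) := by
    ext j
    simp [Pi.single_apply, Finset.sum_add_distrib]
  conv_lhs => rw [hx]
  simp only [map_sum, map_add, map_smul, Complex.re_sum, Complex.mul_re, Complex.conj_re,
    Complex.conj_im, smul_eq_mul]
  exact Finset.sum_congr rfl fun k _ => by ring

/-- Independent complex Gaussians are invariant under maps with orthonormal rows. -/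
lemma map_pi_complexGaussian {ι κ : Type*} [Fintype ι] [Fintype κ] [DecidableEq κ]
    (c : κ → ι → ℂ) (hc : ∀ k k', ∑ i, c k i * conj (c k' i) = if k = k' then 1 else 0) :
    (Measure.pi (fun _ : ι => complexGaussian v)).map (fun x k => ∑ i, c k i * x i) =
      Measure.pi (fun _ : κ => complexGaussian v) := by
  have hm : Measurable (fun (x : ι → ℂ) k => ∑ i, c k i * x i) := by fun_prop
  have := Measure.isProbabilityMeasure_map (μ := Measure.pi (fun _ : ι => complexGaussian v))
    hm.aemeasurable
  -- The characteristic function at `t` depends only on `‖t‖`. Pulling back along `c` replaces `t`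
  -- by `cᴴ t`, which has the same norm because the rows of `c` are orthonormal.
  refine Measure.ext_of_charFunDual ?_
  ext ℓ
  obtain ⟨t, ht⟩ := exists_dual_eq ℓ
  rw [charFunDual_apply, charFunDual_apply, integral_map hm.aemeasurable]
  · simp_rw [ht]
    rw [integral_exp_pi_complexGaussian]
    have h : ∀ x : ι → ℂ, ∑ k, conj (t k) * ∑ i, c k i * x i =
        ∑ i, conj (∑ k, t k * conj (c k i)) * x i := by
      intro x
      simp_rw [map_sum, Finset.mul_sum, Finset.sum_mul, map_mul, Complex.conj_conj]
      rw [Finset.sum_comm]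
      simp only [mul_assoc]
    simp_rw [h]
    rw [integral_exp_pi_complexGaussian]
    have h2 : ∑ i, ‖∑ k, t k * conj (c k i)‖ ^ 2 = ∑ k, ‖t k‖ ^ 2 := by
      have : ((∑ i, ‖∑ k, t k * conj (c k i)‖ ^ 2 : ℝ) : ℂ) = ((∑ k, ‖t k‖ ^ 2 : ℝ) : ℂ) := by
        push_cast
        simp_rw [← Complex.mul_conj', map_sum, map_mul, Complex.conj_conj, Finset.sum_mul_sum]
        rw [Finset.sum_comm]
        refine Finset.sum_congr rfl fun k _ => ?_
        rw [Finset.sum_comm]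
        have : ∀ k', ∑ i, t k * conj (c k i) * (conj (t k') * c k' i) =
            t k * conj (t k') * if k' = k then 1 else 0 := by
          intro k'
          rw [← hc, Finset.mul_sum]
          exact Finset.sum_congr rfl fun i _ => by ring
        simp_rw [this]
        simp
      exact_mod_cast this
    rw [h2]
  · exact Continuous.aestronglyMeasurable (by fun_prop)

lemma complexGaussian_singleton (hv : v ≠ 0) (z : ℂ) : complexGaussian v {z} = 0 := by
  rw [complexGaussian, Measure.map_apply measurable_complex_mk (measurableSet_singleton z)]
  have : (fun p : ℝ × ℝ => (⟨p.1, p.2⟩ : ℂ)) ⁻¹' {z} ⊆ {z.re} ×ˢ {z.im} := by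
    rintro ⟨a, b⟩ h
    simp only [Set.mem_preimage, Set.mem_singleton_iff] at h
    simp [← h]
  refine measure_mono_null this ?_
  rw [Measure.prod_prod]
  have := nullSingletonClass_gaussianReal (μ := 0) hv
  simp

lemma gaussianReal_Icc_lower (hv : v ≠ 0) (C : ℝ) : ∃ κ : ℝ≥0, κ ≠ 0 ∧
    ∀ x r : ℝ, |x| ≤ C → 0 ≤ r → r ≤ 1 →
      κ * ENNReal.ofReal r ≤ gaussianReal 0 v (Set.Icc x (x + r)) := by
  have hκ : 0 < gaussianPDFReal 0 v (|C| + 1) := gaussianPDFReal_pos _ _ _ hv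
  -- The interval lies in `[-(|C| + 1), |C| + 1]`, where the density is at least its value at the
  -- endpoint.
  refine ⟨(gaussianPDFReal 0 v (|C| + 1)).toNNReal, (Real.toNNReal_pos.2 hκ).ne',
    fun x r hx hr hr1 => ?_⟩
  rw [gaussianReal_apply _ hv]
  have h1 : ∀ y ∈ Set.Icc x (x + r),
      ((gaussianPDFReal 0 v (|C| + 1)).toNNReal : ℝ≥0∞) ≤ gaussianPDF 0 v y := by
    intro y hy
    rw [gaussianPDF, ← ENNReal.ofReal]
    apply ENNReal.ofReal_le_ofReal
    simp only [gaussianPDFReal_def]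
    have hy2 : y ^ 2 ≤ (|C| + 1) ^ 2 := by
      rw [sq_le_sq, abs_of_nonneg (by positivity : 0 ≤ |C| + 1)]
      have := le_abs_self C
      rw [abs_le] at hx ⊢
      constructor <;> linarith [hy.1, hy.2]
    simp only [sub_zero]
    gcongr
  calc _ = ∫⁻ _ in Set.Icc x (x + r), ((gaussianPDFReal 0 v (|C| + 1)).toNNReal : ℝ≥0∞) := by
        rw [setLIntegral_const, Real.volume_Icc, add_sub_cancel_left]
    _ ≤ _ := setLIntegral_mono' measurableSet_Icc h1

/-- A disc of squared radius `r` has area of order `r`, so each complex coordinate costs one power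
of `r`. The disc contains a square of side `√(r/2)`, whence the constant `κ² / 2`. -/
lemma complexGaussian_lower (hv : v ≠ 0) (C : ℝ) : ∃ κ : ℝ≥0, κ ≠ 0 ∧
    ∀ (z : ℂ) (r : ℝ), ‖z‖ ≤ C → 0 ≤ r → r ≤ 1 →
      κ * ENNReal.ofReal r ≤ complexGaussian v {w | ‖w - z‖ ^ 2 ≤ r} := by
  obtain ⟨κ, hκ, h⟩ := gaussianReal_Icc_lower hv C
  refine ⟨κ ^ 2 * 2⁻¹, by positivity, fun z r hz hr hr1 => ?_⟩
  have hm : MeasurableSet {w : ℂ | ‖w - z‖ ^ 2 ≤ r} :=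
    measurableSet_le (by fun_prop) measurable_const
  rw [complexGaussian, Measure.map_apply measurable_complex_mk hm]
  have hs : 0 ≤ √(r / 2) := Real.sqrt_nonneg _
  have hsq : √(r / 2) ^ 2 = r / 2 := Real.sq_sqrt (by linarith)
  have hs1 : √(r / 2) ≤ 1 := by
    exact Real.sqrt_le_iff.2 ⟨zero_le_one, by linarith⟩
  have hsub : Set.Icc z.re (z.re + √(r / 2)) ×ˢ Set.Icc z.im (z.im + √(r / 2)) ⊆
      (fun p : ℝ × ℝ => (⟨p.1, p.2⟩ : ℂ)) ⁻¹' {w : ℂ | ‖w - z‖ ^ 2 ≤ r} := by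
    rintro ⟨a, b⟩ ⟨ha, hb⟩
    simp only [Set.mem_Icc] at ha hb
    simp only [Set.mem_preimage, Set.mem_ofPred_eq, ← Complex.normSq_eq_norm_sq,
      Complex.normSq_apply, Complex.sub_re, Complex.sub_im]
    have h1 : (a - z.re) ^ 2 ≤ √(r / 2) ^ 2 := by
      apply pow_le_pow_left₀ <;> linarith
    have h2 : (b - z.im) ^ 2 ≤ √(r / 2) ^ 2 := by
      apply pow_le_pow_left₀ <;> linarith
    rw [hsq] at h1 h2
    nlinarith
  refine le_trans ?_ (measure_mono hsub)
  rw [Measure.prod_prod]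
  refine le_trans (le_of_eq ?_) (mul_le_mul'
    (h z.re _ ((Complex.abs_re_le_norm z).trans hz) hs hs1)
    (h z.im _ ((Complex.abs_im_le_norm z).trans hz) hs hs1))
  have : ENNReal.ofReal r = 2 * (ENNReal.ofReal √(r / 2) * ENNReal.ofReal √(r / 2)) := by
    rw [← ENNReal.ofReal_mul hs, ← sq, hsq, ← ENNReal.ofReal_ofNat,
      ← ENNReal.ofReal_mul (by norm_num)]
    congr 1
    ring
  rw [this]
  push_cast
  calc _ = κ ^ 2 * (ENNReal.ofReal √(r / 2) * ENNReal.ofReal √(r / 2)) * (2⁻¹ * 2) := by ring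
    _ = _ := by
      rw [ENNReal.inv_mul_cancel (by norm_num) (by norm_num)]
      ring

end ComplexGaussian

/-! ### Freezing independent variables, and i.i.d. Gaussian families -/

section Independence

variable {Ω : Type*} [MeasurableSpace Ω] {μ : Measure Ω} {ι κ : Type*} {v : ℝ≥0}

/-- The random variables `X i` are i.i.d. circularly symmetric complex Gaussian. -/
structure IsIIDGaussian (X : ι → Ω → ℂ) (v : ℝ≥0) (μ : Measure Ω) : Prop where
  measurable : ∀ i, Measurable (X i)
  map_eq : ∀ i, μ.map (X i) = complexGaussian v
  indep : iIndepFun X μ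

/-- The σ-algebra generated by the random variables `X i`, `i ∈ s`. -/
noncomputable abbrev sigmaOf {Ω : Type*} (X : ι → Ω → ℂ) (s : Set ι) : MeasurableSpace Ω :=
  ⨆ i ∈ s, MeasurableSpace.comap (X i) inferInstance

lemma measurable_sigmaOf {Ω : Type*} (X : ι → Ω → ℂ) {s : Set ι} {i : ι} (hi : i ∈ s) :
    Measurable[sigmaOf X s] (X i) :=
  Measurable.mono (comap_measurable (X i))
    (le_iSup₂ (f := fun i (_ : i ∈ s) => MeasurableSpace.comap (X i) inferInstance) i hi) le_rfl

lemma measure_prodMk_mem_eq_lintegral {α β : Type*} [MeasurableSpace α] [MeasurableSpace β]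
    [IsFiniteMeasure μ] {X : Ω → α} {Y : Ω → β} (hX : Measurable X) (hY : Measurable Y)
    (h : IndepFun X Y μ) {A : Set (α × β)} (hA : MeasurableSet A) :
    μ {ω | (X ω, Y ω) ∈ A} = ∫⁻ ω', μ {ω | (X ω', Y ω) ∈ A} ∂μ := by
  have h1 := (indepFun_iff_map_prod_eq_prod_map_map hX.aemeasurable hY.aemeasurable).1 h
  have h2 : μ {ω | (X ω, Y ω) ∈ A} = μ.map (fun ω => (X ω, Y ω)) A :=
    (Measure.map_apply (hX.prodMk hY) hA).symm
  rw [h2, h1, Measure.prod_apply hA, lintegral_map (measurable_measure_prodMk_left hA) hX]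
  refine lintegral_congr fun ω' => ?_
  rw [Measure.map_apply hY (measurable_prodMk_left hA)]
  rfl

/-- The conditioning device of the proof: by Fubini, a bound that holds for each frozen value of `X`
holds for the pair. -/
lemma measure_prodMk_mem_le {α β : Type*} [MeasurableSpace α] [MeasurableSpace β]
    [IsProbabilityMeasure μ] {X : Ω → α} {Y : Ω → β} (hX : Measurable X) (hY : Measurable Y)
    (h : IndepFun X Y μ) {A : Set (α × β)} (hA : MeasurableSet A) {c : ℝ≥0∞}
    (hc : ∀ ω', μ {ω | (X ω', Y ω) ∈ A} ≤ c) :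
    μ {ω | (X ω, Y ω) ∈ A} ≤ c := by
  rw [measure_prodMk_mem_eq_lintegral hX hY h hA]
  exact (lintegral_mono hc).trans (by simp)

/-- Events depending on pairwise disjoint sets of coordinates are independent. It is applied with `S
j` the channel entries of user `j`. -/
lemma measure_biInter_le_pow [IsProbabilityMeasure μ] {m : ι → MeasurableSpace Ω}
    (h_le : ∀ i, m i ≤ ‹MeasurableSpace Ω›) (h_indep : iIndep m μ) {S : ℕ → Set ι}
    (hS : Pairwise (Function.onFun Disjoint S)) {E : ℕ → Set Ω}
    (hE : ∀ j, MeasurableSet[⨆ i ∈ S j, m i] (E j)) {c : ℝ≥0∞} (hc : ∀ j, μ (E j) ≤ c)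
    (J : Finset ℕ) : μ (⋂ j ∈ J, E j) ≤ c ^ J.card := by
  induction J using Finset.induction_on with
  | empty => simp
  | insert a J ha ih =>
    have hdis : Disjoint (S a) (⋃ j ∈ J, S j) := by
      rw [Set.disjoint_iUnion₂_right]
      intro j hj
      exact hS (fun h => ha (h ▸ hj))
    have hind := indep_iSup_of_disjoint h_le h_indep hdis
    have hmeas : MeasurableSet[⨆ i ∈ ⋃ j ∈ J, S j, m i] (⋂ j ∈ J, E j) := by
      refine Finset.measurableSet_biInter J fun j hj => ?_
      have : (⨆ i ∈ S j, m i) ≤ ⨆ i ∈ ⋃ j ∈ J, S j, m i :=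
        biSup_mono fun i hi => Set.mem_biUnion (Finset.mem_coe.2 hj) hi
      exact this _ (hE j)
    rw [Finset.set_biInter_insert, Finset.card_insert_of_notMem ha, pow_succ',
      (Indep_iff _ _ μ).1 hind _ _ (hE a) hmeas]
    exact mul_le_mul' (hc a) ih

/-- A measurable real random variable is tight. -/
lemma exists_measure_lt_le [IsFiniteMeasure μ] {f : Ω → ℝ} (hf : Measurable f) {ε : ℝ≥0∞}
    (hε : 0 < ε) : ∃ C : ℝ, 0 < C ∧ μ {ω | C < f ω} ≤ ε := by
  have h : Tendsto (fun n : ℕ => μ {ω | (n : ℝ) < f ω}) atTop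
      (𝓝 (μ (⋂ n : ℕ, {ω | (n : ℝ) < f ω}))) := by
    refine tendsto_measure_iInter_atTop
      (fun n => (measurableSet_lt measurable_const hf).nullMeasurableSet) ?_
      ⟨0, measure_ne_top _ _⟩
    intro a b hab ω hω
    have : (a : ℝ) ≤ b := by exact_mod_cast hab
    exact lt_of_le_of_lt this hω
  have h0 : (⋂ n : ℕ, {ω | (n : ℝ) < f ω}) = ∅ := by
    ext ω
    obtain ⟨n, hn⟩ := exists_nat_ge (f ω)
    simp only [Set.mem_iInter, Set.mem_ofPred_eq, Set.mem_empty_iff_false, iff_false, not_forall,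
      not_lt]
    exact ⟨n, hn⟩
  rw [h0, measure_empty] at h
  obtain ⟨n, hn1, hn2⟩ := ((h.eventually (gt_mem_nhds hε)).and (eventually_gt_atTop 0)).exists
  exact ⟨n, by exact_mod_cast hn2, hn1.le⟩

namespace IsIIDGaussian

variable {X : ι → Ω → ℂ}

lemma precomp (h : IsIIDGaussian X v μ) {g : κ → ι} (hg : g.Injective) :
    IsIIDGaussian (fun k => X (g k)) v μ :=
  ⟨fun _ => h.measurable _, fun _ => h.map_eq _, h.indep.precomp hg⟩

lemma isProbabilityMeasure (h : IsIIDGaussian X v μ) : IsProbabilityMeasure μ :=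
  h.indep.isProbabilityMeasure

lemma map_eq_pi [Fintype ι] (h : IsIIDGaussian X v μ) :
    μ.map (fun ω i => X i ω) = Measure.pi (fun _ => complexGaussian v) := by
  have := h.isProbabilityMeasure
  rw [(iIndepFun_iff_map_fun_eq_pi_map fun i => (h.measurable i).aemeasurable).1 h.indep]
  simp_rw [h.map_eq]

lemma of_map_eq_pi [Fintype ι] [IsProbabilityMeasure μ] (hX : ∀ i, Measurable (X i))
    (h : μ.map (fun ω i => X i ω) = Measure.pi (fun _ => complexGaussian v)) :
    IsIIDGaussian X v μ := by
  have hm : ∀ i, μ.map (X i) = complexGaussian v := by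
    intro i
    have := (measurePreserving_eval (fun _ : ι => complexGaussian v) i).map_eq
    rw [← h, Measure.map_map (measurable_pi_apply i) (measurable_pi_lambda _ hX)] at this
    exact this
  refine ⟨hX, hm, ?_⟩
  rw [iIndepFun_iff_map_fun_eq_pi_map fun i => (hX i).aemeasurable, h]
  simp_rw [hm]

lemma linear [Fintype ι] [Fintype κ] [DecidableEq κ] (h : IsIIDGaussian X v μ) (c : κ → ι → ℂ)
    (hc : ∀ k k', ∑ i, c k i * conj (c k' i) = if k = k' then 1 else 0) :
    IsIIDGaussian (fun k ω => ∑ i, c k i * X i ω) v μ := by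
  have := h.isProbabilityMeasure
  have hX := h.measurable
  refine of_map_eq_pi (fun k => by fun_prop) ?_
  rw [← map_pi_complexGaussian c hc, ← h.map_eq_pi, Measure.map_map (by fun_prop) (by fun_prop)]
  rfl

lemma measure_eq_pi [Fintype ι] (h : IsIIDGaussian X v μ) {A : Set (ι → ℂ)}
    (hA : MeasurableSet A) :
    μ {ω | (fun i => X i ω) ∈ A} = Measure.pi (fun _ => complexGaussian v) A := by
  rw [← h.map_eq_pi, Measure.map_apply (measurable_pi_lambda _ h.measurable) hA]
  rfl

lemma indepFun_of_disjoint (h : IsIIDGaussian X v μ) {s t : Set ι} (hst : Disjoint s t)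
    {α β : Type*} [MeasurableSpace α] [MeasurableSpace β] {F : Ω → α} {G : Ω → β}
    (hF : Measurable[sigmaOf X s] F) (hG : Measurable[sigmaOf X t] G) : IndepFun F G μ := by
  rw [IndepFun_iff_Indep]
  exact indep_of_indep_of_le_left (indep_of_indep_of_le_right
    (indep_iSup_of_disjoint (fun i => (h.measurable i).comap_le) h.indep hst)
    hG.comap_le) hF.comap_le

end IsIIDGaussian

lemma isIIDGaussian_eval [Fintype ι] :
    IsIIDGaussian (fun i (x : ι → ℂ) => x i) v (Measure.pi fun _ : ι => complexGaussian v) :=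
  .of_map_eq_pi (fun i => measurable_pi_apply i) Measure.map_id

end Independence

/-! ### Gaussian square matrices: invertibility and tightness of the inverse -/

section Determinant

variable {v : ℝ≥0}

lemma measurable_det {n : ℕ} {α : Type*} [MeasurableSpace α] {f : α → Matrix (Fin n) (Fin n) ℂ}
    (hf : ∀ a b, Measurable fun x => f x a b) : Measurable fun x => (f x).det := by
  simp only [Matrix.det_apply]
  fun_prop

/-- Cramer's rule gives each entry as a quotient of determinants. It persists at singular matrices,
where inverse and quotient both take the default value `0`. -/
lemma measurable_inv_apply {n : ℕ} {α : Type*} [MeasurableSpace α]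
    {f : α → Matrix (Fin n) (Fin n) ℂ} (hf : ∀ a b, Measurable fun x => f x a b) (a b : Fin n) :
    Measurable fun x => (f x)⁻¹ a b := by
  have h1 : ∀ x, (f x)⁻¹ a b = ((f x).det)⁻¹ * ((f x).updateRow b (Pi.single a 1)).det := by
    intro x
    rw [Matrix.inv_def, Matrix.smul_apply, Matrix.adjugate_apply, Ring.inverse_eq_inv', smul_eq_mul]
  simp_rw [h1]
  refine (measurable_det hf).inv.mul (measurable_det fun c d => ?_)
  by_cases hc : c = b
  · subst hc
    simp
  · simpa [Matrix.updateRow_ne hc] using hf c d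

/-- A square matrix with i.i.d. complex Gaussian entries is almost surely invertible. -/
lemma IsIIDGaussian.det_ne_zero {Ω : Type*} [MeasurableSpace Ω] {μ : Measure Ω} (hv : v ≠ 0)
    {n : ℕ} {X : Fin n × Fin n → Ω → ℂ} (h : IsIIDGaussian X v μ) :
    μ {ω | (Matrix.of fun a b => X (a, b) ω).det = 0} = 0 := by
  have := h.isProbabilityMeasure
  induction n with
  | zero => simp
  | succ n ih =>
    have hminor := ih (h.precomp (g := fun p : Fin n × Fin n => (p.1.succ, p.2.succ))
      (fun p q hpq => by simpa [Prod.ext_iff] using hpq))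
    let M : ({e : Fin (n + 1) × Fin (n + 1) // e ≠ (0, 0)} → ℂ) → ℂ →
        Matrix (Fin (n + 1)) (Fin (n + 1)) ℂ :=
      fun y z => Matrix.of fun a b => if hab : (a, b) ≠ (0, 0) then y ⟨(a, b), hab⟩ else z
    let D : ({e : Fin (n + 1) × Fin (n + 1) // e ≠ (0, 0)} → ℂ) → ℂ :=
      fun y => ((M y 0).submatrix Fin.succ Fin.succ).det
    have hMmeas : ∀ a b, Measurable
        fun p : ({e : Fin (n + 1) × Fin (n + 1) // e ≠ (0, 0)} → ℂ) × ℂ => M p.1 p.2 a b := by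
      intro a b
      by_cases hab : (a, b) ≠ (0, 0)
      · simp only [M, Matrix.of_apply, dif_pos hab]
        fun_prop
      · simp only [M, Matrix.of_apply, dif_neg hab]
        fun_prop
    -- With all entries but the corner frozen, the determinant is affine in the corner entry `z`,
    -- with slope the complementary minor.
    have hdet : ∀ y z, (M y z).det = z * D y + (M y 0).det := by
      intro y z
      have hne : ∀ (j : Fin n), ((0 : Fin (n + 1)), j.succ) ≠ (0, 0) := by simp
      have hne' : ∀ (i : Fin n) j, (i.succ, j) ≠ ((0 : Fin (n + 1)), (0 : Fin (n + 1))) := by simp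
      have hsub : ∀ j, (M y z).submatrix Fin.succ (Fin.succAbove j) =
          (M y 0).submatrix Fin.succ (Fin.succAbove j) := by
        intro j
        ext a b
        simp [M]
      rw [Matrix.det_succ_row_zero, Matrix.det_succ_row_zero (M y 0), Fin.sum_univ_succ,
        Fin.sum_univ_succ]
      simp only [hsub]
      simp [M, D]
    let Y : Ω → {e : Fin (n + 1) × Fin (n + 1) // e ≠ (0, 0)} → ℂ := fun ω e => X e ω
    have hYX : IndepFun Y (X (0, 0)) μ := by
      refine h.indepFun_of_disjoint (s := {e | e ≠ (0, 0)}) (t := {(0, 0)}) (by simp) ?_ ?_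
      · exact @measurable_pi_lambda _ _ _ (sigmaOf X _) _ _ fun e => measurable_sigmaOf X e.2
      · exact measurable_sigmaOf X rfl
    have hYm : Measurable Y := measurable_pi_lambda _ fun e => h.measurable _
    have hMX : ∀ ω, (Matrix.of fun a b => X (a, b) ω) = M (Y ω) (X (0, 0) ω) := by
      intro ω
      ext a b
      by_cases hab : (a, b) = (0, 0)
      · simp only [M, Matrix.of_apply, hab, ne_eq, not_true_eq_false, dite_false]
      · simp only [M, Matrix.of_apply, ne_eq, hab, not_false_eq_true, dite_true, Y]
    have hA : MeasurableSet {p : ({e : Fin (n + 1) × Fin (n + 1) // e ≠ (0, 0)} → ℂ) × ℂ |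
        (M p.1 p.2).det = 0} := measurable_det hMmeas (measurableSet_singleton 0)
    have hfub := measure_prodMk_mem_eq_lintegral hYm (h.measurable _) hYX hA
    simp_rw [hMX]
    have hae : ∀ᵐ ω ∂μ, D (Y ω) ≠ 0 := by
      rw [ae_iff]
      simp only [not_not]
      convert hminor using 6
      ext a b
      simp [M, Y]
    -- The minor is almost surely nonzero by induction. Then a single value of the corner makes the
    -- determinant vanish, and the Gaussian law has no atoms.
    refine hfub.trans ((lintegral_congr_ae (g := 0) ?_).trans lintegral_zero)
    filter_upwards [hae] with ω hω
    have hsub : {ω' | (Y ω, X (0, 0) ω') ∈ {p : ({e : Fin (n + 1) × Fin (n + 1) // e ≠ (0, 0)} → ℂ)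
        × ℂ | (M p.1 p.2).det = 0}} ⊆ X (0, 0) ⁻¹' {-(M (Y ω) 0).det / D (Y ω)} := by
      intro ω' hω'
      have hω'' : (M (Y ω) (X (0, 0) ω')).det = 0 := hω'
      rw [hdet] at hω''
      rw [Set.mem_preimage, Set.mem_singleton_iff, eq_div_iff hω]
      linear_combination hω''
    refine measure_mono_null hsub ?_
    rw [← Measure.map_apply (h.measurable _) (measurableSet_singleton _), h.map_eq,
      complexGaussian_singleton hv]

/-- The invertible `n × n` matrices, given by their entries, whose inverse has squared Frobenius
norm at most `C`. -/
def invBounded (n : ℕ) (C : ℝ) : Set (Fin n × Fin n → ℂ) :=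
  {x | (Matrix.of fun a b => x (a, b)).det ≠ 0 ∧
    ∑ a, ∑ b, ‖(Matrix.of fun a b => x (a, b) : Matrix (Fin n) (Fin n) ℂ)⁻¹ a b‖ ^ 2 ≤ C}

lemma measurable_sum_norm_sq_inv (n : ℕ) : Measurable fun x : Fin n × Fin n → ℂ =>
    ∑ a, ∑ b, ‖(Matrix.of fun a b => x (a, b) : Matrix (Fin n) (Fin n) ℂ)⁻¹ a b‖ ^ 2 :=
  Finset.measurable_sum _ fun a _ => Finset.measurable_sum _ fun b _ =>
    (measurable_inv_apply (fun a b => measurable_pi_apply (a, b)) a b).norm.pow_const 2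

lemma measurableSet_invBounded (n : ℕ) (C : ℝ) : MeasurableSet (invBounded n C) := by
  have h1 : MeasurableSet {x : Fin n × Fin n → ℂ | (Matrix.of fun a b => x (a, b)).det ≠ 0} :=
    (measurable_det (f := fun x : Fin n × Fin n → ℂ => Matrix.of fun a b => x (a, b))
      fun a b => measurable_pi_apply _) (measurableSet_singleton 0).compl
  have h2 := measurableSet_le (measurable_sum_norm_sq_inv n) (measurable_const (a := C))
  exact h1.inter h2

/-- The inverse of a square matrix with i.i.d. complex Gaussian entries is tight. -/
lemma exists_inv_bound (hv : v ≠ 0) (n : ℕ) {ε : ℝ≥0∞} (hε : 0 < ε) : ∃ C : ℝ, 0 < C ∧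
    Measure.pi (fun _ : Fin n × Fin n => complexGaussian v) (invBounded n C)ᶜ ≤ ε := by
  obtain ⟨f, hfdef⟩ : ∃ f : (Fin n × Fin n → ℂ) → ℝ, f = fun x => ∑ a, ∑ b,
      ‖(Matrix.of fun a b => x (a, b) : Matrix (Fin n) (Fin n) ℂ)⁻¹ a b‖ ^ 2 := ⟨_, rfl⟩
  have hf : Measurable f := by
    rw [hfdef]
    exact measurable_sum_norm_sq_inv n
  obtain ⟨C, hC, h⟩ := exists_measure_lt_le
    (μ := Measure.pi (fun _ : Fin n × Fin n => complexGaussian v)) hf hε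
  refine ⟨C, hC, ?_⟩
  have h0 : Measure.pi (fun _ : Fin n × Fin n => complexGaussian v)
      {x | (Matrix.of fun a b => x (a, b)).det = 0} = 0 :=
    (isIIDGaussian_eval (ι := Fin n × Fin n) (v := v)).det_ne_zero hv
  refine le_trans (measure_mono (t := {x | (Matrix.of fun a b => x (a, b)).det = 0} ∪
    {x | C < f x}) ?_) ?_
  swap
  · refine (measure_union_le _ _).trans ?_
    rwa [h0, zero_add]
  intro x hx
  by_cases hd : (Matrix.of fun a b => x (a, b)).det = 0
  · exact Or.inl hd
  · refine Or.inr ?_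
    rw [Set.mem_ofPred_eq]
    by_contra hC'
    rw [hfdef, not_lt] at hC'
    exact hx ⟨hd, hC'⟩

end Determinant

/-! ### Lower tail of the least singular value -/

section SmallSingularValue

variable {v : ℝ≥0}

/-- `B A⁻¹ a` is the value of the remaining entries of the last column that would make the columns
dependent. The σ-algebra on `α` is left free so that it can be the one generated by the other
entries. -/
lemma measurable_det_schur {n d : ℕ} {α : Type*} [MeasurableSpace α]
    {A : α → Matrix (Fin n) (Fin n) ℂ} {B : α → Matrix (Fin d) (Fin n) ℂ} {a : α → Fin n → ℂ}
    (hA : ∀ i j, Measurable fun x => A x i j) (hB : ∀ i j, Measurable fun x => B x i j)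
    (ha : ∀ i, Measurable fun x => a x i) :
    Measurable fun x => ((A x).det, B x *ᵥ ((A x)⁻¹ *ᵥ a x)) := by
  refine (measurable_det hA).prodMk (measurable_pi_lambda _ fun i => ?_)
  simp only [Matrix.mulVec, dotProduct]
  exact Finset.measurable_sum _ fun j _ => (hB i j).mul
    (Finset.measurable_sum _ fun k _ => (measurable_inv_apply hA j k).mul (ha k))

lemma IsIIDGaussian.le_measure_forall_norm_sub_sq_le {Ω : Type*} [MeasurableSpace Ω]
    {μ : Measure Ω} {d : ℕ} {X : Fin d → Ω → ℂ} (h : IsIIDGaussian X v μ) {C : ℝ} {κ : ℝ≥0∞}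
    {r : ℝ} (hκ : ∀ z : ℂ, ‖z‖ ≤ C → κ ≤ complexGaussian v {w | ‖w - z‖ ^ 2 ≤ r})
    (c : Fin d → ℂ) (hc : ∀ i, ‖c i‖ ≤ C) :
    κ ^ d ≤ μ {ω | ∀ i, ‖X i ω - c i‖ ^ 2 ≤ r} := by
  have hset : {ω | ∀ i, ‖X i ω - c i‖ ^ 2 ≤ r} =
      {ω | (fun i => X i ω) ∈ Set.univ.pi fun i => {w : ℂ | ‖w - c i‖ ^ 2 ≤ r}} := by
    ext ω
    simp
  rw [hset, h.measure_eq_pi (MeasurableSet.univ_pi fun i =>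
    measurableSet_le (by fun_prop) measurable_const), Measure.pi_pi]
  calc κ ^ d = ∏ _i : Fin d, κ := by simp
    _ ≤ _ := Finset.prod_le_prod' fun i _ => hκ _ (hc i)

/-- The probability that the smallest squared singular value of a tall matrix with `L` columns
and i.i.d. complex Gaussian entries is at most `ε` is at least of order `ε ^ (card R - L + 1)`. -/
lemma exists_small_singular_value (hv : v ≠ 0) {R : Type*} [Fintype R] {L : ℕ} [NeZero L]
    (hL : L ≤ Fintype.card R) : ∃ c : ℝ≥0, c ≠ 0 ∧ ∀ ε : ℝ, 0 < ε → ε ≤ 1 →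
      ∃ B : Set (R × Fin L → ℂ), MeasurableSet B ∧
        c * ENNReal.ofReal ε ^ (Fintype.card R - L + 1) ≤
          Measure.pi (fun _ => complexGaussian v) B ∧
        ∀ x ∈ B, ∃ y : Fin L → ℂ, 1 ≤ ∑ l, ‖y l‖ ^ 2 ∧
          ∑ r, ‖∑ l, x (r, l) * y l‖ ^ 2 ≤ ε := by
  obtain ⟨n, rfl⟩ : ∃ n, L = n + 1 := ⟨L - 1, by have := NeZero.pos L; omega⟩
  set d := Fintype.card R - (n + 1) + 1 with hd
  have hd0 : (0 : ℝ) < d := by rw [hd]; positivity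
  -- The matrix is cut into blocks `[A a; B b]` with `A` square of size `L - 1`; the column piece
  -- `b` has `d = card R - L + 1` entries, the exponent sought.
  have e : Fin n ⊕ Fin d ≃ R := Fintype.equivOfCardEq (by simp [hd]; omega)
  let P := Measure.pi (fun _ : R × Fin (n + 1) => complexGaussian v)
  have hP : IsIIDGaussian (fun i (x : R × Fin (n + 1) → ℂ) => x i) v P := isIIDGaussian_eval
  let A : (R × Fin (n + 1) → ℂ) → Matrix (Fin n) (Fin n) ℂ :=
    fun x => Matrix.of fun i j => x (e (.inl i), j.castSucc)
  let B : (R × Fin (n + 1) → ℂ) → Matrix (Fin d) (Fin n) ℂ :=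
    fun x => Matrix.of fun i j => x (e (.inr i), j.castSucc)
  let a : (R × Fin (n + 1) → ℂ) → Fin n → ℂ := fun x i => x (e (.inl i), Fin.last n)
  let b : (R × Fin (n + 1) → ℂ) → Fin d → ℂ := fun x i => x (e (.inr i), Fin.last n)
  let F : (R × Fin (n + 1) → ℂ) → ℂ × (Fin d → ℂ) :=
    fun x => ((A x).det, B x *ᵥ ((A x)⁻¹ *ᵥ a x))
  have hF : Measurable F := measurable_det_schur (fun i j => measurable_pi_apply _)
    (fun i j => measurable_pi_apply _) (fun i => measurable_pi_apply _)
  have hb : Measurable b := measurable_pi_lambda _ fun i => measurable_pi_apply _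
  let s : Set (R × Fin (n + 1)) := Set.range fun i : Fin d => (e (.inr i), Fin.last n)
  have hFb : IndepFun F b P := by
    refine hP.indepFun_of_disjoint (disjoint_compl_left (a := s)) ?_ ?_
    · refine @measurable_det_schur n d _ (sigmaOf _ sᶜ) A B a (fun i j => ?_) (fun i j => ?_)
        (fun i => ?_)
      · refine measurable_sigmaOf (fun i (x : R × Fin (n + 1) → ℂ) => x i)
          (i := (e (.inl i), j.castSucc)) ?_
        simp [s]
      · refine measurable_sigmaOf (fun i (x : R × Fin (n + 1) → ℂ) => x i)
          (i := (e (.inr i), j.castSucc)) ?_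
        simp [s, (Fin.castSucc_lt_last j).ne']
      · refine measurable_sigmaOf (fun i (x : R × Fin (n + 1) → ℂ) => x i)
          (i := (e (.inl i), Fin.last n)) ?_
        simp [s]
    · refine @measurable_pi_lambda _ _ _ (sigmaOf _ s) _ _ fun i => ?_
      exact measurable_sigmaOf (fun i (x : R × Fin (n + 1) → ℂ) => x i) (Set.mem_range_self i)
  have hdet : P {x | (A x).det = 0} = 0 :=
    (hP.precomp (g := fun p : Fin n × Fin n => (e (.inl p.1), p.2.castSucc))
      (fun p q hpq => by simpa [Prod.ext_iff] using hpq)).det_ne_zero hv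
  -- With probability at least one half the target `B A⁻¹ a` stays in a fixed ball, where the
  -- Gaussian density is bounded below.
  obtain ⟨C, -, hC⟩ := exists_measure_lt_le (μ := P) (f := fun x => ∑ i, ‖(F x).2 i‖)
    (by fun_prop) (ε := 2⁻¹) (by simp)
  let Good : Set (R × Fin (n + 1) → ℂ) := {x | (A x).det ≠ 0 ∧ ∀ i, ‖(F x).2 i‖ ≤ C}
  have hGoodm : MeasurableSet Good := by
    have h1 : MeasurableSet {x | (A x).det ≠ 0} :=
      (measurable_det (fun i j => measurable_pi_apply _)) (measurableSet_singleton 0).compl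
    have h2 : MeasurableSet {x | ∀ i, ‖(F x).2 i‖ ≤ C} := by
      simp_rw [Set.ofPred_forall]
      exact MeasurableSet.iInter fun i => measurableSet_le (by fun_prop) measurable_const
    exact h1.inter h2
  have hGood : 2⁻¹ ≤ P Good := by
    have h1 : P Goodᶜ ≤ 2⁻¹ := by
      refine le_trans (measure_mono (t := {x | (A x).det = 0} ∪
        {x | C < ∑ i, ‖(F x).2 i‖}) ?_) ?_
      · intro x hx
        by_cases hd : (A x).det = 0
        · exact Or.inl hd
        · refine Or.inr ?_
          rw [Set.mem_ofPred_eq]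
          by_contra hlt
          refine hx ⟨hd, fun i => ?_⟩
          exact (Finset.single_le_sum (f := fun i => ‖(F x).2 i‖) (fun i _ => norm_nonneg _)
            (Finset.mem_univ i)).trans (not_lt.1 hlt)
      · refine (measure_union_le _ _).trans ?_
        rwa [hdet, zero_add]
    rw [prob_compl_eq_one_sub hGoodm, tsub_le_iff_right] at h1
    have h2 : (1 : ℝ≥0∞) = 2⁻¹ + 2⁻¹ := (ENNReal.inv_two_add_inv_two).symm
    rw [h2] at h1
    exact (ENNReal.add_le_add_iff_left (by simp)).1 h1
  obtain ⟨κ, hκ0, hκ⟩ := complexGaussian_lower hv C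
  -- One half for the event `Good`, and `κ ε / d` for each of the `d` entries of `b` to come within
  -- squared distance `ε / d` of its target.
  refine ⟨2⁻¹ * (κ * (d : ℝ≥0)⁻¹) ^ d, ?_, fun ε hε hε1 => ?_⟩
  · have : (d : ℝ≥0) ≠ 0 := by rw [hd]; positivity
    positivity
  have hr0 : 0 ≤ ε / d := by positivity
  have hr1 : ε / d ≤ 1 := by
    rw [div_le_one hd0]
    refine hε1.trans ?_
    rw [hd]
    push_cast
    linarith [Nat.cast_nonneg (α := ℝ) (Fintype.card R - (n + 1))]
  let T : Set ((ℂ × (Fin d → ℂ)) × (Fin d → ℂ)) :=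
    {p | p.1.1 ≠ 0 ∧ ∀ i, ‖p.2 i - p.1.2 i‖ ^ 2 ≤ ε / d}
  have hT : MeasurableSet T := by
    have h1 : MeasurableSet {p : (ℂ × (Fin d → ℂ)) × (Fin d → ℂ) | p.1.1 ≠ 0} :=
      (measurable_fst.comp measurable_fst) (measurableSet_singleton 0).compl
    have h2 : MeasurableSet {p : (ℂ × (Fin d → ℂ)) × (Fin d → ℂ) |
        ∀ i, ‖p.2 i - p.1.2 i‖ ^ 2 ≤ ε / d} := by
      simp_rw [Set.ofPred_forall]
      exact MeasurableSet.iInter fun i => measurableSet_le (by fun_prop) measurable_const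
    exact h1.inter h2
  refine ⟨{x | (F x, b x) ∈ T}, (hF.prodMk hb) hT, ?_, ?_⟩
  · change _ ≤ P _
    rw [measure_prodMk_mem_eq_lintegral hF hb hFb hT]
    have hinner : ∀ x ∈ Good, (κ * ENNReal.ofReal (ε / d)) ^ d ≤ P {y | (F x, b y) ∈ T} := by
      intro x hx
      refine ((hP.precomp (g := fun i : Fin d => (e (.inr i), Fin.last n))
        (fun p q hpq => by simpa [Prod.ext_iff] using hpq)).le_measure_forall_norm_sub_sq_le
        (fun z hz => hκ z _ hz hr0 hr1) (F x).2 hx.2).trans (measure_mono ?_)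
      intro y hy
      exact ⟨hx.1, hy⟩
    calc _ = (κ * ENNReal.ofReal (ε / d)) ^ d * 2⁻¹ := by
          rw [ENNReal.ofReal_div_of_pos hd0, ENNReal.ofReal_natCast, div_eq_mul_inv, ENNReal.coe_mul,
            ENNReal.coe_pow, ENNReal.coe_mul]
          rw [ENNReal.coe_inv (by norm_num), ENNReal.coe_inv (by simp [hd])]
          push_cast
          ring
      _ ≤ (κ * ENNReal.ofReal (ε / d)) ^ d * P Good := by gcongr
      _ = ∫⁻ _ in Good, (κ * ENNReal.ofReal (ε / d)) ^ d ∂P := by rw [setLIntegral_const]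
      _ ≤ ∫⁻ x in Good, P {y | (F x, b y) ∈ T} ∂P := setLIntegral_mono' hGoodm hinner
      _ ≤ _ := setLIntegral_le_lintegral _ _
  · rintro x ⟨hx1, hx2⟩
    let z : Fin n → ℂ := (A x)⁻¹ *ᵥ a x
    -- For `y = (A⁻¹ a, -1)` the first `n` rows give zero and the others give `B A⁻¹ a - b`; the
    -- last coordinate alone ensures `‖y‖ ≥ 1`.
    refine ⟨Fin.snoc (α := fun _ => ℂ) z (-1), ?_, ?_⟩
    · rw [Fin.sum_univ_castSucc]
      simp only [Fin.snoc_castSucc, Fin.snoc_last, norm_neg, norm_one, one_pow]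
      linarith [Finset.sum_nonneg fun (i : Fin n) (_ : i ∈ Finset.univ) => sq_nonneg ‖z i‖]
    · rw [← e.sum_comp, Fintype.sum_sum_type]
      simp only [Fin.sum_univ_castSucc, Fin.snoc_castSucc, Fin.snoc_last]
      have hA : ∀ i, ∑ j : Fin n, x (e (.inl i), j.castSucc) * z j = a x i := by
        intro i
        change (A x *ᵥ z) i = a x i
        simp only [z]
        rw [Matrix.mulVec_mulVec, Matrix.mul_nonsing_inv _ (Ne.isUnit hx1), Matrix.one_mulVec]
      have hB : ∀ i, ∑ j : Fin n, x (e (.inr i), j.castSucc) * z j = (F x).2 i := fun i => rfl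
      simp only [hA, hB]
      have h1 : ∀ i, a x i + x (e (.inl i), Fin.last n) * -1 = 0 := fun i => by simp [a]
      have h2 : ∀ i, ‖(F x).2 i + x (e (.inr i), Fin.last n) * -1‖ ^ 2 ≤ ε / d := by
        intro i
        have := hx2 i
        rw [norm_sub_rev] at this
        simpa [b, sub_eq_add_neg] using this
      simp only [h1, norm_zero, ne_eq, OfNat.ofNat_ne_zero, not_false_eq_true, zero_pow,
        Finset.sum_const_zero, zero_add]
      calc _ ≤ ∑ _i : Fin d, ε / d := Finset.sum_le_sum fun i _ => h2 i
        _ = ε := by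
          rw [Finset.sum_const, Finset.card_univ, Fintype.card_fin, nsmul_eq_mul]
          field_simp

end SmallSingularValue

/-! ### Extremal properties of the last singular vector -/

section SVD

lemma star_dotProduct_self_eq {n : Type*} [Fintype n] (x : n → ℂ) :
    star x ⬝ᵥ x = ((∑ i, ‖x i‖ ^ 2 : ℝ) : ℂ) := by
  simp only [dotProduct, Pi.star_apply, Complex.star_def, Complex.conj_mul']
  push_cast
  rfl

lemma sum_norm_sq_mulVec {m n : Type*} [Fintype m] [Fintype n] [DecidableEq n]
    {U : Matrix m n ℂ} (hU : Uᴴ * U = 1) (x : n → ℂ) :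
    ∑ i, ‖(U *ᵥ x) i‖ ^ 2 = ∑ j, ‖x j‖ ^ 2 := by
  have : star (U *ᵥ x) ⬝ᵥ (U *ᵥ x) = star x ⬝ᵥ x := by
    rw [Matrix.star_mulVec, ← Matrix.dotProduct_mulVec, Matrix.mulVec_mulVec, hU,
      Matrix.one_mulVec]
  rw [star_dotProduct_self_eq, star_dotProduct_self_eq] at this
  exact_mod_cast this

variable {R : Type} [Fintype R] {L : ℕ} [NeZero L] (svd : SVDRule R L)

lemma SVDRule.mulVec_eq (G : Matrix R (Fin L) ℂ) (y : Fin L → ℂ) :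
    ∑ r, ‖(G *ᵥ y) r‖ ^ 2 =
      ∑ l, svd.sing G l ^ 2 * ‖((svd.right G)ᴴ *ᵥ y) l‖ ^ 2 := by
  conv_lhs => rw [svd.factor G]
  simp_rw [← Matrix.mulVec_mulVec]
  rw [sum_norm_sq_mulVec (svd.left_orthonormal G)]
  refine Finset.sum_congr rfl fun l _ => ?_
  rw [Matrix.mulVec_diagonal, norm_mul, mul_pow, Complex.norm_real, Real.norm_eq_abs, sq_abs]

/-- `V` is square, hence unitary, so `Vᴴ y` keeps the norm of `y` and each coordinate is scaled by
at least the last singular value. A single explicit test vector therefore bounds the metric. -/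
lemma SVDRule.sing_sq_mul_le (G : Matrix R (Fin L) ℂ) (y : Fin L → ℂ) :
    svd.sing G ⊤ ^ 2 * ∑ l, ‖y l‖ ^ 2 ≤ ∑ r, ‖(G *ᵥ y) r‖ ^ 2 := by
  have hV : ((svd.right G)ᴴ)ᴴ * (svd.right G)ᴴ = 1 := by
    rw [Matrix.conjTranspose_conjTranspose]
    exact mul_eq_one_comm.1 (svd.right_orthonormal G)
  rw [svd.mulVec_eq, ← sum_norm_sq_mulVec hV y, Finset.mul_sum]
  refine Finset.sum_le_sum fun l _ => ?_
  have h1 := svd.sing_antitone G (le_top (a := l))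
  have h2 := svd.sing_nonneg G ⊤
  gcongr

lemma SVDRule.sum_norm_sq_mulVec_last (G : Matrix R (Fin L) ℂ) :
    ∑ r, ‖(G *ᵥ fun l => svd.right G l ⊤) r‖ ^ 2 = svd.sing G ⊤ ^ 2 := by
  have h : (svd.right G)ᴴ *ᵥ (fun l => svd.right G l ⊤) = Pi.single ⊤ 1 := by
    ext l
    have := congrFun (congrFun (svd.right_orthonormal G) l) ⊤
    rw [Matrix.one_apply] at this
    rw [Pi.single_apply]
    exact this
  rw [svd.mulVec_eq, h, Finset.sum_eq_single ⊤]
  · simp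
  · intro l _ hl
    simp [hl]
  · simp

lemma SVDRule.sum_norm_sq_last (G : Matrix R (Fin L) ℂ) :
    ∑ l, ‖svd.right G l ⊤‖ ^ 2 = 1 := by
  have := congrFun (congrFun (svd.right_orthonormal G) ⊤) ⊤
  rw [Matrix.one_apply_eq] at this
  have h2 := star_dotProduct_self_eq fun l => svd.right G l ⊤
  have h3 : star (fun l => svd.right G l ⊤) ⬝ᵥ (fun l => svd.right G l ⊤) = 1 := this
  rw [h3] at h2
  exact_mod_cast h2.symm

end SVD

/-! ### Selection of the smallest metrics -/

/-- If some good user `g t` is not picked, no picked user has a larger metric than it. Otherwise all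
`S` good users are picked, and by counting they are exactly the picked ones. -/
lemma SelectionRule.pick_le {S n : ℕ} (sel : SelectionRule S) (η : ℕ → ℝ) {ε : ℝ}
    (g : Fin S → ℕ) (hg : Function.Injective g) (hgn : ∀ s, g s < n) (hgε : ∀ s, η (g s) ≤ ε)
    (s : Fin S) : η (sel.pick n (fun j : Fin n => η j) s) ≤ ε := by
  have hSn : S ≤ n := by
    have := Fintype.card_le_of_injective (fun s => (⟨g s, hgn s⟩ : Fin n))
      (fun a b hab => hg (by simpa using hab))
    simpa using this
  set p := sel.pick n (fun j : Fin n => η j) with hp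
  have hpn : ∀ s, p s < n := fun s => sel.pick_lt _ _ s hSn
  by_cases h : ∃ t, ∀ s', p s' ≠ g t
  · obtain ⟨t, ht⟩ := h
    exact (sel.pick_smallest n (fun j : Fin n => η j) hSn ⟨p s, hpn s⟩ ⟨g t, hgn t⟩
      ⟨s, rfl⟩ ht).trans (hgε t)
  · push Not at h
    choose q hq using h
    have hqinj : Function.Injective q := fun a b hab => hg (by rw [← hq a, ← hq b, hab])
    obtain ⟨t, rfl⟩ := (Finite.injective_iff_surjective.1 hqinj) s
    rw [hq]
    exact hgε t

/-! ### Deterministic rate bound -/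

section Rate

variable {K M L S : ℕ}

lemma crossLink_mulVec (U : Fin K → Matrix (Fin M) (Fin S) ℂ)
    (H : Fin K → Fin K → ℕ → Matrix (Fin M) (Fin L) ℂ) (i : Fin K) (j : ℕ) (y : Fin L → ℂ)
    (r : {k : Fin K // k ≠ i} × Fin S) :
    (crossLink U H i j *ᵥ y) r = ((U r.1)ᴴ *ᵥ (H r.1 i j *ᵥ y)) r.2 := by
  rw [Matrix.mulVec_mulVec]
  rfl

variable [NeZero L]
  (svd : (i : Fin K) → ℕ → SVDRule ({k : Fin K // k ≠ i} × Fin S) L)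
  (U : Fin K → Matrix (Fin M) (Fin S) ℂ)
  (H : Fin K → Fin K → ℕ → Matrix (Fin M) (Fin L) ℂ)

lemma metric_eq (i : Fin K) (j : ℕ) :
    metric svd U H i j = ∑ r, ‖(crossLink U H i j *ᵥ weight svd U H i j) r‖ ^ 2 :=
  ((svd i j).sum_norm_sq_mulVec_last _).symm

/-- The metric of a user in cell `k` sums its leakage over all foreign base stations, and base
station `i` is one of the summands. -/
lemma sum_norm_sq_effChannel_le_metric (π : Fin K → Fin S → ℕ) {i k : Fin K} (hik : i ≠ k)
    (m : Fin S) :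
    ∑ a, ‖effChannel U H (weight svd U H) π i k a m‖ ^ 2 ≤ metric svd U H k (π k m) := by
  rw [metric_eq, Fintype.sum_prod_type]
  simp_rw [crossLink_mulVec]
  have heq : ∀ a, effChannel U H (weight svd U H) π i k a m =
      ((U i)ᴴ *ᵥ (H i k (π k m) *ᵥ weight svd U H k (π k m))) a := fun _ => rfl
  simp_rw [heq]
  have h := Finset.single_le_sum (f := fun x : {i : Fin K // i ≠ k} =>
      ∑ a, ‖((U x)ᴴ *ᵥ (H x k (π k m) *ᵥ weight svd U H k (π k m))) a‖ ^ 2)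
    (fun x _ => by positivity) (Finset.mem_univ ⟨i, hik⟩)
  exact h

lemma norm_sq_dotProduct_le {n : Type*} [Fintype n] (x y : n → ℂ) :
    ‖x ⬝ᵥ y‖ ^ 2 ≤ (∑ i, ‖x i‖ ^ 2) * ∑ i, ‖y i‖ ^ 2 := by
  refine le_trans ?_ (Finset.sum_mul_sq_le_sq_mul_sq Finset.univ (fun i => ‖x i‖) fun i => ‖y i‖)
  gcongr
  refine (norm_sum_le _ _).trans (le_of_eq ?_)
  simp

lemma le_rate (π : Fin K → Fin S → ℕ) {snr C : ℝ} (hsnr : 1 ≤ snr)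
    (hη : ∀ k m, metric svd U H k (π k m) ≤ snr⁻¹) (i : Fin K)
    (hdet : (effChannel U H (weight svd U H) π i i).det ≠ 0)
    (hC : ∑ a, ∑ b, ‖(effChannel U H (weight svd U H) π i i)⁻¹ a b‖ ^ 2 ≤ C) (s : Fin S) :
    Real.log snr - Real.log (C * (1 + K * S)) ≤ rate U H (weight svd U H) π snr i s := by
  set w := weight svd U H
  set T := effChannel U H w π i i
  have hsnr0 : 0 < snr := by linarith
  let φ : ℝ := ∑ a, ‖zfEqualizer U H w π i a s‖ ^ 2
  have hφT : φ = ∑ a, ‖T⁻¹ s a‖ ^ 2 := by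
    simp only [φ, zfEqualizer, Matrix.conjTranspose_apply, norm_star]
    rfl
  have hφC : φ ≤ C := by
    rw [hφT]
    exact (Finset.single_le_sum (f := fun a => ∑ b, ‖T⁻¹ a b‖ ^ 2)
      (fun a _ => by positivity) (Finset.mem_univ s)).trans hC
  -- Positivity matters: a zero denominator would give the default rate `0`. It holds because a row
  -- of an invertible inverse cannot vanish.
  have hφ0 : 0 < φ := by
    refine lt_of_le_of_ne (by positivity) fun h0 => ?_
    rw [hφT] at h0
    have hz : ∀ a, T⁻¹ s a = 0 := by
      intro a
      have := (Finset.sum_eq_zero_iff_of_nonneg (fun a _ => by positivity)).1 h0.symm a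
        (Finset.mem_univ a)
      simpa using this
    have h1 := congrFun (congrFun (Matrix.nonsing_inv_mul T (Ne.isUnit hdet)) s) s
    rw [Matrix.mul_apply, Matrix.one_apply_eq] at h1
    simp [hz] at h1
  have hterm : ∀ k ∈ Finset.univ.erase i, ∀ m,
      ‖star ((zfEqualizer U H w π i).col s) ⬝ᵥ (effChannel U H w π i k).col m‖ ^ 2 * snr ≤ φ := by
    intro k hk m
    have hik : i ≠ k := (Finset.ne_of_mem_erase hk).symm
    have h1 := norm_sq_dotProduct_le (star ((zfEqualizer U H w π i).col s))
      ((effChannel U H w π i k).col m)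
    simp only [Pi.star_apply, norm_star, Matrix.col_apply] at h1
    have h2 := (sum_norm_sq_effChannel_le_metric svd U H π hik m).trans (hη k m)
    calc _ ≤ φ * snr⁻¹ * snr := by
          refine mul_le_mul_of_nonneg_right (h1.trans ?_) hsnr0.le
          exact mul_le_mul_of_nonneg_left h2 hφ0.le
      _ = φ := by field_simp
  -- The `(K-1)S` terms are generously counted as `K S`; only boundedness of the factor matters.
  have hI : interference U H w π snr i s ≤ φ * (K * S) := by
    calc interference U H w π snr i s ≤ ∑ k ∈ Finset.univ.erase i, ∑ m : Fin S, φ :=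
          Finset.sum_le_sum fun k hk => Finset.sum_le_sum fun m _ => hterm k hk m
      _ ≤ ∑ k : Fin K, ∑ m : Fin S, φ :=
          Finset.sum_le_sum_of_subset_of_nonneg (Finset.erase_subset _ _)
            fun _ _ _ => by positivity
      _ = φ * (K * S) := by
          simp
          ring
  have hI0 : 0 ≤ interference U H w π snr i s := by
    unfold interference
    positivity
  have hD0 : 0 < φ + interference U H w π snr i s := by linarith
  have hD : φ + interference U H w π snr i s ≤ C * (1 + K * S) := by
    calc _ ≤ φ * (1 + K * S) := by linarith
      _ ≤ _ := by gcongr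
  have hC0 : 0 < C * (1 + K * S) := hD0.trans_le hD
  rw [← Real.log_div hsnr0.ne' hC0.ne']
  change _ ≤ Real.log (1 + snr / (φ + interference U H w π snr i s))
  apply Real.log_le_log (by positivity)
  have : snr / (C * (1 + K * S)) ≤ snr / (φ + interference U H w π snr i s) := by gcongr
  linarith

lemma le_sumRate_div (sel : Fin K → SelectionRule S) {n : ℕ} {snr C δ : ℝ} (hsnr : 1 < snr)
    (hsnrδ : K * S * Real.log (C * (1 + K * S)) ≤ δ * Real.log snr)
    (hη : ∀ k m, metric svd U H k (selected svd sel U H n k m) ≤ snr⁻¹)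
    (hT : ∀ i, (effChannel U H (weight svd U H) (selected svd sel U H n) i i).det ≠ 0 ∧
      ∑ a, ∑ b, ‖(effChannel U H (weight svd U H) (selected svd sel U H n) i i)⁻¹ a b‖ ^ 2
        ≤ C) :
    (K * S : ℝ) - δ ≤ sumRate svd sel U H n snr / Real.log snr := by
  have hlog : 0 < Real.log snr := Real.log_pos hsnr
  rw [le_div_iff₀ hlog]
  calc ((K * S : ℝ) - δ) * Real.log snr
      ≤ ∑ _i : Fin K, ∑ _s : Fin S, (Real.log snr - Real.log (C * (1 + K * S))) := by
        simp only [Finset.sum_const, Finset.card_univ, Fintype.card_fin, nsmul_eq_mul]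
        linarith
    _ ≤ _ := Finset.sum_le_sum fun i _ => Finset.sum_le_sum fun s _ =>
        le_rate svd U H _ hsnr.le hη i (hT i).1 (hT i).2 s

end Rate

/-! ### Measurability of the scheme -/

section Measurability

variable {K M L S : ℕ} {α : Type*} [MeasurableSpace α]
  {U : α → Fin K → Matrix (Fin M) (Fin S) ℂ}
  {H : α → Fin K → Fin K → ℕ → Matrix (Fin M) (Fin L) ℂ}

lemma crossLink_apply (U : Fin K → Matrix (Fin M) (Fin S) ℂ)
    (H : Fin K → Fin K → ℕ → Matrix (Fin M) (Fin L) ℂ) (i : Fin K) (j : ℕ)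
    (r : {k : Fin K // k ≠ i} × Fin S) (l : Fin L) :
    crossLink U H i j r l = ∑ m, conj (U r.1 m r.2) * H r.1 i j m l := rfl

lemma effChannel_apply (U : Fin K → Matrix (Fin M) (Fin S) ℂ)
    (H : Fin K → Fin K → ℕ → Matrix (Fin M) (Fin L) ℂ) (w : Fin K → ℕ → Fin L → ℂ)
    (π : Fin K → Fin S → ℕ) (i k : Fin K) (a s : Fin S) :
    effChannel U H w π i k a s =
      ∑ m, conj (U i m a) * ∑ l, H i k (π k s) m l * w k (π k s) l := rfl

lemma measurable_crossLink (hU : ∀ k m s, Measurable fun x => U x k m s)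
    (hH : ∀ k i j m l, Measurable fun x => H x k i j m l) (i : Fin K) (j : ℕ)
    (r : {k : Fin K // k ≠ i} × Fin S) (l : Fin L) :
    Measurable fun x => crossLink (U x) (H x) i j r l := by
  simp_rw [crossLink_apply]
  exact Finset.measurable_sum _ fun m _ =>
    (Complex.continuous_conj.measurable.comp (hU _ _ _)).mul (hH _ _ _ _ _)

/-- Handles the random indices of the scheduled users; it works because `ℕ` is countable. -/
lemma measurable_eval_nat {β : Type*} [MeasurableSpace β] {f : ℕ → α → β}
    (hf : ∀ n, Measurable (f n)) {p : α → ℕ} (hp : Measurable p) :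
    Measurable fun x => f (p x) x := by
  have h : Measurable fun q : ℕ × α => f q.1 q.2 := measurable_from_prod_countable_right hf
  exact h.comp (hp.prodMk measurable_id)

variable [NeZero L] (svd : (i : Fin K) → ℕ → SVDRule ({k : Fin K // k ≠ i} × Fin S) L)
  (sel : Fin K → SelectionRule S)

lemma measurable_weight (hU : ∀ k m s, Measurable fun x => U x k m s)
    (hH : ∀ k i j m l, Measurable fun x => H x k i j m l) (i : Fin K) (j : ℕ) (l : Fin L) :
    Measurable fun x => weight svd (U x) (H x) i j l :=
  ((svd i j).measurable_last l).comp (measurable_pi_lambda _ fun r => measurable_pi_lambda _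
    fun l => measurable_crossLink hU hH i j r l)

lemma measurable_metric (hU : ∀ k m s, Measurable fun x => U x k m s)
    (hH : ∀ k i j m l, Measurable fun x => H x k i j m l) (i : Fin K) (j : ℕ) :
    Measurable fun x => metric svd (U x) (H x) i j := by
  simp_rw [metric_eq]
  simp only [Matrix.mulVec, dotProduct]
  exact Finset.measurable_sum _ fun r _ => (Finset.measurable_sum _ fun l _ =>
    (measurable_crossLink hU hH i j r l).mul
      (measurable_weight svd hU hH i j l)).norm.pow_const 2

lemma measurable_selected (hU : ∀ k m s, Measurable fun x => U x k m s)
    (hH : ∀ k i j m l, Measurable fun x => H x k i j m l) (n : ℕ) (i : Fin K) (s : Fin S) :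
    Measurable fun x => selected svd sel (U x) (H x) n i s :=
  (measurable_pi_apply s).comp (((sel i).measurable_pick n).comp
    (measurable_pi_lambda _ fun j : Fin n => measurable_metric svd hU hH i j))

lemma measurable_effChannel (hU : ∀ k m s, Measurable fun x => U x k m s)
    (hH : ∀ k i j m l, Measurable fun x => H x k i j m l) (n : ℕ) (i : Fin K) (a s : Fin S) :
    Measurable fun x => effChannel (U x) (H x) (weight svd (U x) (H x))
      (selected svd sel (U x) (H x) n) i i a s := by
  simp_rw [effChannel_apply]
  exact measurable_eval_nat (f := fun j x => ∑ m, conj (U x i m a) *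
      ∑ l, H x i i j m l * weight svd (U x) (H x) i j l)
    (fun j => Finset.measurable_sum _ fun m _ =>
      (Complex.continuous_conj.measurable.comp (hU _ _ _)).mul
        (Finset.measurable_sum _ fun l _ => (hH _ _ _ _ _).mul (measurable_weight svd hU hH i j l)))
    (measurable_selected svd sel hU hH n i s)

end Measurability

/-! ### Laws of cross-link and direct channels for fixed bases -/

section FixedBasis

variable {K M L S : ℕ} {Ω : Type*} [MeasurableSpace Ω] {μ : Measure Ω} {v : ℝ≥0}

/-- The channel matrices as a function of the family of their entries. -/
def channel (h : Fin K × Fin K × ℕ × Fin M × Fin L → ℂ) :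
    Fin K → Fin K → ℕ → Matrix (Fin M) (Fin L) ℂ :=
  fun k i j => Matrix.of fun m l => h (k, i, j, m, l)

/-- Rows of `U_kᴴ` are orthonormal, and different base stations or different antennas of the user
involve disjoint channel entries, so the whole linear map has orthonormal rows. -/
lemma isIIDGaussian_crossLink {X : Fin K × Fin K × ℕ × Fin M × Fin L → Ω → ℂ}
    (hX : IsIIDGaussian X v μ) {U : Fin K → Matrix (Fin M) (Fin S) ℂ}
    (hU : ∀ k, (U k)ᴴ * U k = 1) (i : Fin K) (j : ℕ) :
    IsIIDGaussian (fun (p : ({k : Fin K // k ≠ i} × Fin S) × Fin L) ω =>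
      crossLink U (channel fun e => X e ω) i j p.1 p.2) v μ := by
  have hinj : Function.Injective fun q : {k : Fin K // k ≠ i} × Fin M × Fin L =>
      ((q.1 : Fin K), i, j, q.2.1, q.2.2) := by
    rintro ⟨⟨k, hk⟩, m, l⟩ ⟨⟨k', hk'⟩, m', l'⟩ h
    simpa using h
  have := (hX.precomp hinj).linear
    (fun (p : ({k : Fin K // k ≠ i} × Fin S) × Fin L) q =>
      if q.1 = p.1.1 then if q.2.2 = p.2 then conj (U p.1.1 q.2.1 p.1.2) else 0 else 0) ?_
  · convert this using 3 with p ω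
    rw [crossLink_apply, Fintype.sum_prod_type]
    simp_rw [Fintype.sum_prod_type]
    simp [channel]
  · rintro ⟨⟨k, s⟩, l⟩ ⟨⟨k', s'⟩, l'⟩
    rw [Fintype.sum_prod_type]
    simp_rw [Fintype.sum_prod_type]
    by_cases hk : k = k'
    · subst hk
      by_cases hl : l = l'
      · subst hl
        have h1 := congrFun (congrFun (hU k) s) s'
        rw [Matrix.mul_apply, Matrix.one_apply] at h1
        simpa using h1
      · simp [hl]
    · simp [hk]

lemma measure_forall_crossLink_notMem_le [IsProbabilityMeasure μ]
    {X : Fin K × Fin K × ℕ × Fin M × Fin L → Ω → ℂ}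
    (hX : IsIIDGaussian X v μ) {U : Fin K → Matrix (Fin M) (Fin S) ℂ}
    (hU : ∀ k, (U k)ᴴ * U k = 1) (i : Fin K)
    {B : Set (({k : Fin K // k ≠ i} × Fin S) × Fin L → ℂ)} (hB : MeasurableSet B) (J : Finset ℕ) :
    μ {ω | ∀ j ∈ J, (fun p : ({k : Fin K // k ≠ i} × Fin S) × Fin L =>
        crossLink U (channel fun e => X e ω) i j p.1 p.2) ∉ B} ≤
      (1 - Measure.pi (fun _ => complexGaussian v) B) ^ J.card := by
  let E : ℕ → Set Ω := fun j => {ω | (fun p : ({k : Fin K // k ≠ i} × Fin S) × Fin L =>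
        crossLink U (channel fun e => X e ω) i j p.1 p.2) ∉ B}
  let s : ℕ → Set (Fin K × Fin K × ℕ × Fin M × Fin L) := fun j => {e | e.2.2.1 = j}
  have hs : Pairwise (Function.onFun Disjoint s) := by
    intro a b hab
    rw [Function.onFun, Set.disjoint_left]
    rintro e rfl hb
    exact hab hb
  have hE : ∀ j, MeasurableSet[sigmaOf X (s j)] (E j) := by
    intro j
    have hm : Measurable[sigmaOf X (s j)] fun ω =>
        (fun p : ({k : Fin K // k ≠ i} × Fin S) × Fin L =>
          crossLink U (channel fun e => X e ω) i j p.1 p.2) := by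
      refine @measurable_pi_lambda _ _ _ (sigmaOf X (s j)) _ _ fun p => ?_
      simp_rw [crossLink_apply]
      refine @Finset.measurable_sum _ _ _ _ _ _ (sigmaOf X (s j)) _ _ fun m _ => ?_
      exact (measurable_sigmaOf X (s := s j) (i := (p.1.1.1, i, j, m, p.2)) rfl).const_mul _
    exact hm hB.compl
  have hEle : ∀ j, μ (E j) ≤ 1 - Measure.pi (fun _ => complexGaussian v) B := by
    intro j
    have h := (isIIDGaussian_crossLink hX hU i j).measure_eq_pi hB.compl
    rw [prob_compl_eq_one_sub hB] at h
    exact h.le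
  have := measure_biInter_le_pow (fun e => (hX.measurable e).comap_le) hX.indep hs hE hEle J
  refine le_trans (measure_mono ?_) this
  intro ω hω
  exact Set.mem_iInter₂.2 hω

/-- If the users of cell `i` have fixed unit weights and the scheduled users are fixed and
distinct, then the entries of their effective channel are i.i.d. Gaussian. -/
lemma isIIDGaussian_effChannel {X : Fin K × Fin K × ℕ × Fin M × Fin L → Ω → ℂ}
    (hX : IsIIDGaussian X v μ) {U : Fin K → Matrix (Fin M) (Fin S) ℂ} (i : Fin K)
    (hU : (U i)ᴴ * U i = 1) {w : Fin K → ℕ → Fin L → ℂ} {π : Fin K → Fin S → ℕ}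
    (hw : ∀ j, ∑ l, ‖w i j l‖ ^ 2 = 1) (hπ : Function.Injective (π i)) :
    IsIIDGaussian (fun (p : Fin S × Fin S) ω =>
      effChannel U (channel fun e => X e ω) w π i i p.1 p.2) v μ := by
  have hinj : Function.Injective fun q : Fin S × Fin M × Fin L =>
      (i, i, π i q.1, q.2.1, q.2.2) := by
    rintro ⟨s, m, l⟩ ⟨s', m', l'⟩ h
    simpa [hπ.eq_iff] using h
  have := (hX.precomp hinj).linear
    -- The coefficient rows are tensor products of a column of `U` (conjugated) with a unit weight.
    -- Distinct scheduled users use disjoint entries, which gives orthogonality across columns.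
    (fun (p : Fin S × Fin S) q =>
      if q.1 = p.2 then conj (U i q.2.1 p.1) * w i (π i p.2) q.2.2 else 0) ?_
  · convert this using 3 with p ω
    rw [effChannel_apply, Fintype.sum_prod_type]
    simp_rw [Fintype.sum_prod_type]
    rw [Finset.sum_eq_single p.2]
    · simp only [if_true, Finset.mul_sum, channel, Matrix.of_apply]
      exact Finset.sum_congr rfl fun m _ => Finset.sum_congr rfl fun l _ => by ring
    · intro s _ hs
      simp [hs]
    · simp
  · rintro ⟨a, s⟩ ⟨a', s'⟩
    rw [Fintype.sum_prod_type]
    simp_rw [Fintype.sum_prod_type]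
    by_cases hs : s = s'
    · subst hs
      have h1 := congrFun (congrFun hU a) a'
      rw [Matrix.mul_apply, Matrix.one_apply] at h1
      have h2 : ∑ l, w i (π i s) l * conj (w i (π i s) l) = 1 := by
        simp_rw [Complex.mul_conj']
        exact_mod_cast hw (π i s)
      rw [Finset.sum_eq_single s]
      · simp only [if_true, map_mul, Complex.conj_conj]
        have h3 : ∀ m l, conj (U i m a) * w i (π i s) l * (U i m a' * conj (w i (π i s) l)) =
            (conj (U i m a) * U i m a') * (w i (π i s) l * conj (w i (π i s) l)) :=
          fun m l => by ring
        simp_rw [h3]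
        rw [← Finset.sum_mul_sum, h2, mul_one]
        simpa using h1
      · intro s' _ hs'
        simp [hs']
      · simp
    · have h4 : ((a, s) : Fin S × Fin S) ≠ (a', s') := by simp [hs]
      rw [if_neg h4]
      refine Finset.sum_eq_zero fun t _ => Finset.sum_eq_zero fun m _ => Finset.sum_eq_zero
        fun l _ => ?_
      by_cases ht : t = s
      · subst ht
        simp [hs]
      · simp [ht]

variable [NeZero L] (svd : (i : Fin K) → ℕ → SVDRule ({k : Fin K // k ≠ i} × Fin S) L)
  (sel : Fin K → SelectionRule S)

/-- The matrix equalized by base station `i`. -/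
def directChannel (U : Fin K → Matrix (Fin M) (Fin S) ℂ)
    (H : Fin K → Fin K → ℕ → Matrix (Fin M) (Fin L) ℂ) (n : ℕ) (i : Fin K) :
    Matrix (Fin S) (Fin S) ℂ :=
  effChannel U H (weight svd U H) (selected svd sel U H n) i i

/-- This, with `selected_congr`, is the source of independence: what happens in cell `i` before
equalization ignores the channels to its own base station. -/
lemma weight_congr {U : Fin K → Matrix (Fin M) (Fin S) ℂ}
    {H H' : Fin K → Fin K → ℕ → Matrix (Fin M) (Fin L) ℂ} {i : Fin K}
    (h : ∀ k ≠ i, H k i = H' k i) : weight svd U H i = weight svd U H' i := by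
  have hc : crossLink U H i = crossLink U H' i := by
    ext j r l
    simp only [crossLink_apply, h r.1 r.1.2]
  ext j l
  simp only [weight, hc]

lemma selected_congr {U : Fin K → Matrix (Fin M) (Fin S) ℂ}
    {H H' : Fin K → Fin K → ℕ → Matrix (Fin M) (Fin L) ℂ} {i : Fin K}
    (h : ∀ k ≠ i, H k i = H' k i) (n : ℕ) :
    selected svd sel U H n i = selected svd sel U H' n i := by
  have hc : crossLink U H i = crossLink U H' i := by
    ext j r l
    simp only [crossLink_apply, h r.1 r.1.2]
  simp only [selected, metric, hc]

/-- Scheduling does not bias the direct channels. With all channels outside the block `(i, i)`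
frozen, weights and scheduled users are constants and the matrix is i.i.d. Gaussian; the bound is
then integrated. -/
lemma measure_directChannel_le [IsProbabilityMeasure μ]
    {X : Fin K × Fin K × ℕ × Fin M × Fin L → Ω → ℂ}
    (hX : IsIIDGaussian X v μ) {U : Fin K → Matrix (Fin M) (Fin S) ℂ}
    (i : Fin K) (hU : (U i)ᴴ * U i = 1) {n : ℕ} (hn : S ≤ n)
    {B : Set (Fin S × Fin S → ℂ)} (hB : MeasurableSet B) :
    μ {ω | (fun p : Fin S × Fin S =>
        directChannel svd sel U (channel fun e => X e ω) n i p.1 p.2) ∈ B} ≤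
      Measure.pi (fun _ => complexGaussian v) B := by
  let D : Set (Fin K × Fin K × ℕ × Fin M × Fin L) := {e | e.1 = i ∧ e.2.1 = i}
  -- The channel family is written as `x + y`, with `y` the direct channels of cell `i` and `x` all
  -- the others, each padded with zeros; `x` and `y` are independent.
  let x : Ω → Fin K × Fin K × ℕ × Fin M × Fin L → ℂ :=
    fun ω e => if e.1 = i ∧ e.2.1 = i then 0 else X e ω
  let y : Ω → Fin K × Fin K × ℕ × Fin M × Fin L → ℂ :=
    fun ω e => if e.1 = i ∧ e.2.1 = i then X e ω else 0
  have hxD : Measurable[sigmaOf X Dᶜ] x := by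
    refine @measurable_pi_lambda _ _ _ (sigmaOf X Dᶜ) _ _ fun e => ?_
    by_cases he : e.1 = i ∧ e.2.1 = i
    · simp only [x, if_pos he]
      exact @measurable_const _ _ _ (sigmaOf X Dᶜ) _
    · simp only [x, if_neg he]
      exact measurable_sigmaOf X (s := Dᶜ) he
  have hyD : Measurable[sigmaOf X D] y := by
    refine @measurable_pi_lambda _ _ _ (sigmaOf X D) _ _ fun e => ?_
    by_cases he : e.1 = i ∧ e.2.1 = i
    · simp only [y, if_pos he]
      exact measurable_sigmaOf X (s := D) he
    · simp only [y, if_neg he]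
      exact @measurable_const _ _ _ (sigmaOf X D) _
  have hle : ∀ s : Set (Fin K × Fin K × ℕ × Fin M × Fin L), sigmaOf X s ≤ ‹MeasurableSpace Ω› :=
    fun s => iSup₂_le fun e _ => (hX.measurable e).comap_le
  let A : Set ((Fin K × Fin K × ℕ × Fin M × Fin L → ℂ) × (Fin K × Fin K × ℕ × Fin M × Fin L → ℂ)) :=
    {q | (fun p : Fin S × Fin S =>
        directChannel svd sel U (channel (q.1 + q.2)) n i p.1 p.2) ∈ B}
  have hA : MeasurableSet A := by
    refine (measurable_pi_lambda _ fun p => ?_) hB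
    refine measurable_effChannel svd sel (U := fun _ => U) (fun _ _ _ => measurable_const)
      (fun k i j m l => ?_) n i p.1 p.2
    simp only [channel, Matrix.of_apply, Pi.add_apply]
    fun_prop
  have hsum : ∀ ω, (fun e => X e ω) = x ω + y ω := by
    intro ω
    ext e
    simp only [x, y, Pi.add_apply]
    split_ifs <;> simp
  have hind := hX.indepFun_of_disjoint (disjoint_compl_left (a := D)) hxD hyD
  simp_rw [hsum]
  refine measure_prodMk_mem_le (hxD.mono (hle _) le_rfl) (hyD.mono (hle _) le_rfl) hind hA
    fun ω' => ?_
  have hcross : ∀ ω, ∀ k ≠ i, channel (x ω' + y ω) k i = channel (x ω') k i := by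
    intro ω k hk
    ext j m l
    simp [channel, y, hk]
  have hT := isIIDGaussian_effChannel hX (U := U) i hU (w := weight svd U (channel (x ω')))
    (π := selected svd sel U (channel (x ω')) n)
    (fun j => (svd i j).sum_norm_sq_last _) ((sel i).pick_injective n _ hn)
  rw [← hT.measure_eq_pi hB]
  refine measure_mono fun ω hω => ?_
  have heq : (fun p : Fin S × Fin S =>
      directChannel svd sel U (channel (x ω' + y ω)) n i p.1 p.2) =
      fun p => effChannel U (channel fun e => X e ω) (weight svd U (channel (x ω')))
        (selected svd sel U (channel (x ω')) n) i i p.1 p.2 := by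
    ext p
    rw [directChannel, effChannel_apply, effChannel_apply, weight_congr svd (hcross ω),
      selected_congr svd sel (hcross ω)]
    simp [channel, x, y]
  have h : (fun p : Fin S × Fin S =>
      directChannel svd sel U (channel (x ω' + y ω)) n i p.1 p.2) ∈ B := hω
  rw [heq] at h
  exact h

end FixedBasis

/-! ### User scaling and blocks of users -/

/-- If each of `N / S` independent users is good with probability at least `c * snr⁻¹ ^ d` and
`snr ^ d = o(N)`, then the probability that no user is good vanishes. -/
lemma tendsto_one_sub_pow_zero {d S : ℕ} (hS : 0 < S) {c : ℝ≥0} (hc : c ≠ 0) {N : ℝ → ℕ}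
    (hN : (fun snr : ℝ => snr ^ d) =o[atTop] fun snr => (N snr : ℝ)) :
    Tendsto (fun snr : ℝ => (1 - c * ENNReal.ofReal snr⁻¹ ^ d : ℝ≥0∞) ^ (N snr / S)) atTop
      (𝓝 0) := by
  have hc0 : (0 : ℝ) < c := NNReal.coe_pos.2 (pos_iff_ne_zero.2 hc)
  have hS0 : (0 : ℝ) < S := by exact_mod_cast hS
  have hlarge : Tendsto (fun snr : ℝ => c * snr⁻¹ ^ d * ((N snr / S : ℕ) : ℝ)) atTop atTop := by
    rw [tendsto_atTop]
    intro b
    -- Eventually `N` is at least this constant times `snr ^ d`; the extra `c` in it pays for the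
    -- user lost in rounding `N / S` down.
    have hA : 0 < S * (|b| + c) / c := by positivity
    have h1 := (isLittleO_iff.1 hN) (inv_pos.2 hA)
    filter_upwards [h1, eventually_ge_atTop 1] with snr h2 hsnr
    have hsnr0 : 0 < snr := by linarith
    have hp : 1 ≤ snr ^ d := one_le_pow₀ hsnr
    have hp0 : 0 < snr ^ d := by linarith
    rw [Real.norm_of_nonneg hp0.le, Real.norm_of_nonneg (Nat.cast_nonneg _), inv_mul_eq_div,
      le_div_iff₀ hA, ← mul_div_assoc, div_le_iff₀ hc0] at h2
    have h3 : (N snr : ℝ) < S * ((N snr / S : ℕ) + 1) := by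
      exact_mod_cast Nat.lt_mul_div_succ _ hS
    have h4 : snr ^ d * (|b| + c) ≤ ((N snr / S : ℕ) + 1) * c := by
      refine le_of_mul_le_mul_left ?_ hS0
      nlinarith
    have h5 : snr ^ d * |b| ≤ c * ((N snr / S : ℕ) : ℝ) := by nlinarith
    rw [inv_pow]
    calc b ≤ |b| := le_abs_self b
      _ = (snr ^ d)⁻¹ * (snr ^ d * |b|) := by field_simp
      _ ≤ (snr ^ d)⁻¹ * (c * ((N snr / S : ℕ) : ℝ)) := by gcongr
      _ = _ := by ring
  have hlim : Tendsto (fun snr : ℝ => ENNReal.ofReal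
      (Real.exp (-(c * snr⁻¹ ^ d * ((N snr / S : ℕ) : ℝ))))) atTop (𝓝 0) := by
    rw [← ENNReal.ofReal_zero]
    exact ENNReal.tendsto_ofReal (Real.tendsto_exp_neg_atTop_nhds_zero.comp hlarge)
  refine tendsto_of_tendsto_of_tendsto_of_le_of_le' tendsto_const_nhds hlim
    (Eventually.of_forall fun _ => zero_le) ?_
  filter_upwards [eventually_ge_atTop 1] with snr hsnr
  have hr : 0 ≤ snr⁻¹ := by positivity
  have h1 : (1 - c * ENNReal.ofReal snr⁻¹ ^ d : ℝ≥0∞) ≤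
      ENNReal.ofReal (Real.exp (-(c * snr⁻¹ ^ d))) := by
    rw [← ENNReal.ofReal_pow hr, ← ENNReal.ofReal_coe_nnreal, ← ENNReal.ofReal_mul hc0.le,
      ← ENNReal.ofReal_one, ← ENNReal.ofReal_sub _ (by positivity)]
    exact ENNReal.ofReal_le_ofReal (Real.one_sub_le_exp_neg _)
  calc _ ≤ ENNReal.ofReal (Real.exp (-(c * snr⁻¹ ^ d))) ^ (N snr / S) := by gcongr
    _ = _ := by
      rw [← ENNReal.ofReal_pow (Real.exp_nonneg _), ← Real.exp_nat_mul]
      congr 2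
      ring

lemma metric_le_of_small {K M L S : ℕ} [NeZero L]
    (svd : (i : Fin K) → ℕ → SVDRule ({k : Fin K // k ≠ i} × Fin S) L)
    (U : Fin K → Matrix (Fin M) (Fin S) ℂ)
    (H : Fin K → Fin K → ℕ → Matrix (Fin M) (Fin L) ℂ) (i : Fin K) (j : ℕ) {ε : ℝ}
    {y : Fin L → ℂ} (hy : 1 ≤ ∑ l, ‖y l‖ ^ 2)
    (h : ∑ r, ‖∑ l, crossLink U H i j r l * y l‖ ^ 2 ≤ ε) : metric svd U H i j ≤ ε :=
  (le_mul_of_one_le_right (sq_nonneg _) hy).trans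
    (((svd i j).sing_sq_mul_le (crossLink U H i j) y).trans h)

/-- One good user per block gives `S` distinct good users, since division by `q` recovers the block
index. -/
lemma exists_injective_of_blocks {S n q : ℕ} (hq : q = n / S) {P : ℕ → Prop}
    (h : ∀ s : Fin S, ∃ j ∈ Finset.Ico (s * q) ((s + 1) * q), P j) :
    ∃ g : Fin S → ℕ, Function.Injective g ∧ (∀ s, g s < n) ∧ ∀ s, P (g s) := by
  choose g hg hP using h
  simp only [Finset.mem_Ico] at hg
  refine ⟨g, fun a b hab => ?_, fun s => ?_, hP⟩
  · have key : ∀ s : Fin S, g s / q = s := fun s =>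
      Nat.div_eq_of_lt_le (hg s).1 (hg s).2
    exact Fin.ext (by rw [← key a, ← key b, hab])
  · calc g s < (s + 1) * q := (hg s).2
      _ ≤ S * q := Nat.mul_le_mul_right _ s.2
      _ ≤ n := hq ▸ Nat.mul_div_le n S

lemma measurable_channel {K M L : ℕ} {α : Type*} [MeasurableSpace α]
    {f : α → Fin K × Fin K × ℕ × Fin M × Fin L → ℂ} (hf : Measurable f) (k i : Fin K) (j : ℕ)
    (m : Fin M) (l : Fin L) : Measurable fun x => channel (f x) k i j m l :=
  measurable_pi_iff.1 hf _

/-- The reference bases as a function of the family of their entries. -/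
def basis {K M S : ℕ} (u : Fin K × Fin M × Fin S → ℂ) : Fin K → Matrix (Fin M) (Fin S) ℂ :=
  fun k => Matrix.of fun m s => u (k, m, s)

lemma measurable_basis {K M S : ℕ} {α : Type*} [MeasurableSpace α]
    {f : α → Fin K × Fin M × Fin S → ℂ} (hf : Measurable f) (k : Fin K) (m : Fin M) (s : Fin S) :
    Measurable fun x => basis (f x) k m s :=
  measurable_pi_iff.1 hf _

/-! ### Random bases independent of the channels -/

section RandomBasis

variable {K M L S : ℕ} {Ω : Type*} [MeasurableSpace Ω] {μ : Measure Ω} [IsProbabilityMeasure μ]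
  {v : ℝ≥0} {X : Fin K × Fin K × ℕ × Fin M × Fin L → Ω → ℂ} {u : Ω → Fin K × Fin M × Fin S → ℂ}

lemma measure_forall_crossLink_notMem_le_of_indepFun (hX : IsIIDGaussian X v μ) (hu : Measurable u)
    (huX : IndepFun u (fun ω e => X e ω) μ)
    (hU : ∀ ω k, (basis (u ω) k)ᴴ * basis (u ω) k = 1) (i : Fin K)
    {B : Set (({k : Fin K // k ≠ i} × Fin S) × Fin L → ℂ)} (hB : MeasurableSet B) (J : Finset ℕ) :
    μ {ω | ∀ j ∈ J, (fun p : ({k : Fin K // k ≠ i} × Fin S) × Fin L =>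
        crossLink (basis (u ω)) (channel fun e => X e ω) i j p.1 p.2) ∉ B} ≤
      (1 - Measure.pi (fun _ => complexGaussian v) B) ^ J.card := by
  let A : Set ((Fin K × Fin M × Fin S → ℂ) × (Fin K × Fin K × ℕ × Fin M × Fin L → ℂ)) :=
    {q | ∀ j ∈ J, (fun p : ({k : Fin K // k ≠ i} × Fin S) × Fin L =>
        crossLink (basis q.1) (channel q.2) i j p.1 p.2) ∉ B}
  have hA : MeasurableSet A := by
    have hAeq : A = ⋂ j ∈ J, (fun (q : (Fin K × Fin M × Fin S → ℂ) ×
        (Fin K × Fin K × ℕ × Fin M × Fin L → ℂ)) (p : ({k : Fin K // k ≠ i} × Fin S) × Fin L) =>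
        crossLink (basis q.1) (channel q.2) i j p.1 p.2) ⁻¹' Bᶜ := by
      ext q
      simp [A]
    rw [hAeq]
    refine Finset.measurableSet_biInter _ fun j _ => ?_
    have hm : Measurable fun (q : (Fin K × Fin M × Fin S → ℂ) ×
        (Fin K × Fin K × ℕ × Fin M × Fin L → ℂ)) (p : ({k : Fin K // k ≠ i} × Fin S) × Fin L) =>
        crossLink (basis q.1) (channel q.2) i j p.1 p.2 := by
      refine measurable_pi_lambda _ fun p => ?_
      exact measurable_crossLink (U := fun q : (Fin K × Fin M × Fin S → ℂ) ×
        (Fin K × Fin K × ℕ × Fin M × Fin L → ℂ) => basis q.1) (H := fun q => channel q.2)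
        (fun k m s => measurable_basis measurable_fst k m s)
        (fun k i j m l => measurable_channel measurable_snd k i j m l) i j p.1 p.2
    exact hm hB.compl
  exact measure_prodMk_mem_le hu (measurable_pi_lambda _ hX.measurable) huX hA fun ω' =>
    measure_forall_crossLink_notMem_le hX (hU ω') i hB J

lemma measure_directChannel_le_of_indepFun [NeZero L]
    (svd : (i : Fin K) → ℕ → SVDRule ({k : Fin K // k ≠ i} × Fin S) L)
    (sel : Fin K → SelectionRule S) (hX : IsIIDGaussian X v μ) (hu : Measurable u)
    (huX : IndepFun u (fun ω e => X e ω) μ)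
    (hU : ∀ ω k, (basis (u ω) k)ᴴ * basis (u ω) k = 1) (i : Fin K) {n : ℕ} (hn : S ≤ n)
    {B : Set (Fin S × Fin S → ℂ)} (hB : MeasurableSet B) :
    μ {ω | (fun p : Fin S × Fin S =>
        directChannel svd sel (basis (u ω)) (channel fun e => X e ω) n i p.1 p.2) ∈ B} ≤
      Measure.pi (fun _ => complexGaussian v) B := by
  let A : Set ((Fin K × Fin M × Fin S → ℂ) × (Fin K × Fin K × ℕ × Fin M × Fin L → ℂ)) :=
    {q | (fun p : Fin S × Fin S =>
        directChannel svd sel (basis q.1) (channel q.2) n i p.1 p.2) ∈ B}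
  have hA : MeasurableSet A := by
    have hm : Measurable fun (q : (Fin K × Fin M × Fin S → ℂ) ×
        (Fin K × Fin K × ℕ × Fin M × Fin L → ℂ)) (p : Fin S × Fin S) =>
        directChannel svd sel (basis q.1) (channel q.2) n i p.1 p.2 := by
      refine measurable_pi_lambda _ fun p => ?_
      exact measurable_effChannel svd sel (U := fun q : (Fin K × Fin M × Fin S → ℂ) ×
        (Fin K × Fin K × ℕ × Fin M × Fin L → ℂ) => basis q.1) (H := fun q => channel q.2)
        (fun k m s => measurable_basis measurable_fst k m s)
        (fun k i j m l => measurable_channel measurable_snd k i j m l) n i p.1 p.2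
    exact hm hB
  exact measure_prodMk_mem_le hu (measurable_pi_lambda _ hX.measurable) huX hA fun ω' =>
    measure_directChannel_le svd sel hX i (hU ω' i) hn hB

end RandomBasis

end OIA

/-! ### The main theorem -/

open OIA in
theorem theorem2
    {K M L S : ℕ} [NeZero L] (hSM : S ≤ M) (hLS : L < (K - 1) * S + 1)
    {Ω : Type*} [MeasurableSpace Ω] (μ : Measure Ω) [IsProbabilityMeasure μ]
    -- the channel matrices: independent and identically distributed complex Gaussian entries
    (H : Fin K → Fin K → ℕ → Ω → Matrix (Fin M) (Fin L) ℂ)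
    (v : ℝ≥0) (hv : v ≠ 0)
    (hH_meas : ∀ k i j m l, Measurable fun ω => H k i j ω m l)
    (hH_law : ∀ k i j m l, μ.map (fun ω => H k i j ω m l) = OIA.complexGaussian v)
    (hH_indep : iIndepFun
      (fun (e : Fin K × Fin K × ℕ × Fin M × Fin L) (ω : Ω) =>
        H e.1 e.2.1 e.2.2.1 ω e.2.2.2.1 e.2.2.2.2) μ)
    -- the reference bases, generated independently of the channels
    (Q : Fin K → Ω → Matrix (Fin M) (Fin (M - S)) ℂ)
    (U : Fin K → Ω → Matrix (Fin M) (Fin S) ℂ)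
    (hQU : ∀ k ω, OIA.IsReferenceBasis (Q k ω) (U k ω))
    (hU_meas : ∀ k m s, Measurable fun ω => U k ω m s)
    (hUH : IndepFun
      (fun (ω : Ω) (e : Fin K × Fin M × Fin S) => U e.1 ω e.2.1 e.2.2)
      (fun (ω : Ω) (e : Fin K × Fin K × ℕ × Fin M × Fin L) =>
        H e.1 e.2.1 e.2.2.1 ω e.2.2.2.1 e.2.2.2.2) μ)
    -- the singular value decompositions of the users, the selection rules of the base stations
    (svd : (i : Fin K) → ℕ → OIA.SVDRule ({k : Fin K // k ≠ i} × Fin S) L)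
    (sel : Fin K → OIA.SelectionRule S)
    -- the number of users per cell as a function of the SNR
    (N : ℝ → ℕ)
    (hN : (fun snr : ℝ => snr ^ ((K - 1) * S - L + 1)) =o[atTop] fun snr => (N snr : ℝ)) :
    ∀ δ : ℝ, 0 < δ →
      Tendsto
        (fun snr : ℝ => μ {ω | (K * S : ℝ) - δ ≤
          OIA.sumRate svd sel (fun k => U k ω) (fun k i j => H k i j ω) (N snr) snr
            / Real.log snr})
        atTop (𝓝 1) := by
  intro δ hδ
  have hL : L ≤ (K - 1) * S := Nat.lt_succ_iff.1 hLS
  have hL0 : 0 < L := NeZero.pos L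
  have hS : 0 < S := Nat.pos_of_ne_zero fun h => by simp [h] at hL; omega
  have hK : 0 < K := Nat.pos_of_ne_zero fun h => by simp [h] at hL; omega
  have hcard : ∀ i : Fin K, Fintype.card ({k : Fin K // k ≠ i} × Fin S) = (K - 1) * S := by
    intro i
    simp
  let X : Fin K × Fin K × ℕ × Fin M × Fin L → Ω → ℂ :=
    fun e ω => H e.1 e.2.1 e.2.2.1 ω e.2.2.2.1 e.2.2.2.2
  have hX : IsIIDGaussian X v μ := ⟨fun e => hH_meas _ _ _ _ _, fun e => hH_law _ _ _ _ _, hH_indep⟩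
  let u : Ω → Fin K × Fin M × Fin S → ℂ := fun ω e => U e.1 ω e.2.1 e.2.2
  have hum : Measurable u := measurable_pi_lambda _ fun e => hU_meas _ _ _
  have hUU : ∀ ω k, (basis (u ω) k)ᴴ * basis (u ω) k = 1 := fun ω k => (hQU k ω).orthonormal
  -- Probabilities never exceed one, so only the lower bound needs proof. The room above `a` is
  -- split into one `ε` for finding good users and one for bounding the equalizers.
  rw [tendsto_order]
  refine ⟨fun a ha => ?_, fun a ha => Eventually.of_forall fun _ => prob_le_one.trans_lt ha⟩
  obtain ⟨ε, hε0, hε⟩ : ∃ ε : ENNReal, 0 < ε ∧ a + (ε + ε) < 1 := by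
    have h1 : 0 < 1 - a := tsub_pos_of_lt ha
    obtain ⟨ε, h2, h3⟩ := exists_between h1
    refine ⟨ε / 2, ENNReal.half_pos h2.ne', ?_⟩
    rw [ENNReal.add_halves]
    exact lt_tsub_iff_left.1 h3
  have hεK : 0 < ε / K := ENNReal.div_pos hε0.ne' (by simp)
  obtain ⟨C, hC0, hC⟩ := exists_inv_bound hv S hεK
  choose c hc0 hc using fun i : Fin K => exists_small_singular_value hv
    (R := {k : Fin K // k ≠ i} × Fin S) (L := L) (by rw [hcard]; exact hL)
  simp only [hcard] at hc
  have hsum : Tendsto (fun snr : ℝ => ∑ i : Fin K, ∑ _s : Fin S,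
      (1 - c i * ENNReal.ofReal snr⁻¹ ^ ((K - 1) * S - L + 1) : ENNReal) ^ (N snr / S)) atTop
      (𝓝 0) := by
    have := tendsto_finsetSum (Finset.univ : Finset (Fin K)) fun i _ =>
      tendsto_finsetSum (Finset.univ : Finset (Fin S)) fun _ _ =>
        tendsto_one_sub_pow_zero hS (hc0 i) hN
    simpa using this
  have hNS : ∀ᶠ snr in atTop, S ≤ N snr := by
    filter_upwards [(isLittleO_iff.1 hN) (c := (S : ℝ)⁻¹) (by positivity),
      eventually_ge_atTop 1] with snr h1 hsnr
    have hp : 1 ≤ snr ^ ((K - 1) * S - L + 1) := one_le_pow₀ hsnr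
    rw [Real.norm_of_nonneg (by linarith), Real.norm_of_nonneg (Nat.cast_nonneg _),
      inv_mul_eq_div, le_div_iff₀ (by positivity)] at h1
    have : (S : ℝ) ≤ N snr := by nlinarith [Nat.cast_nonneg (α := ℝ) S]
    exact_mod_cast this
  filter_upwards [hsum.eventually (ge_mem_nhds hε0), hNS, eventually_gt_atTop 1,
    (Real.tendsto_log_atTop.const_mul_atTop hδ).eventually_ge_atTop
      (K * S * Real.log (C * (1 + K * S)))] with snr hsnr1 hn hsnr hlog
  have hinv0 : 0 < snr⁻¹ := by positivity
  have hinv1 : snr⁻¹ ≤ 1 := inv_le_one_of_one_le₀ hsnr.le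
  -- The scale `snr⁻¹` is the one at which the factor `snr` in the interference cancels.
  choose B hBm hBp hBy using fun i => hc i snr⁻¹ hinv0 hinv1
  set n := N snr
  let E := {ω | (K * S : ℝ) - δ ≤
    sumRate svd sel (fun k => U k ω) (fun k i j => H k i j ω) n snr / Real.log snr}
  let W : Fin K → Fin S → Set Ω := fun i s =>
    {ω | ∀ j ∈ Finset.Ico (s * (n / S)) ((s + 1) * (n / S)),
      (fun p : ({k : Fin K // k ≠ i} × Fin S) × Fin L =>
        crossLink (basis (u ω)) (channel fun e => X e ω) i j p.1 p.2) ∉ B i}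
  let Z : Fin K → Set Ω := fun i => {ω | (fun p : Fin S × Fin S =>
    directChannel svd sel (basis (u ω)) (channel fun e => X e ω) n i p.1 p.2) ∈ (invBounded S C)ᶜ}
  have hW : ∀ i s, μ (W i s) ≤
      (1 - c i * ENNReal.ofReal snr⁻¹ ^ ((K - 1) * S - L + 1) : ENNReal) ^ (n / S) := by
    intro i s
    refine (measure_forall_crossLink_notMem_le_of_indepFun hX hum hUH hUU i (hBm i) _).trans ?_
    have hcardJ : (Finset.Ico (s * (n / S)) ((s + 1) * (n / S))).card = n / S := by
      rw [Nat.card_Ico, ← Nat.sub_mul]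
      simp
    rw [hcardJ]
    gcongr
    exact hBp i
  have hZ : ∀ i, μ (Z i) ≤ ε / K := fun i =>
    (measure_directChannel_le_of_indepFun svd sel hX hum hUH hUU i hn
      (measurableSet_invBounded S C).compl).trans hC
  -- `W i s` says that block `s` of cell `i` has no good user, `Z i` that equalizer `i` is missing
  -- or too large. Only subadditivity is applied to this cover, so measurability of `E` is not
  -- needed.
  have hcover : Set.univ ⊆ E ∪ ((⋃ i, ⋃ s, W i s) ∪ ⋃ i, Z i) := by
    intro ω _
    by_contra hω
    simp only [Set.mem_union, Set.mem_iUnion, not_or, not_exists] at hω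
    obtain ⟨hωE, hωW, hωZ⟩ := hω
    refine hωE (le_sumRate_div svd (fun k => U k ω) (fun k i j => H k i j ω) sel hsnr hlog
      (fun k => ?_) fun i => ?_)
    · obtain ⟨g, hg, hgn, hgB⟩ := exists_injective_of_blocks (n := n) rfl
        (P := fun j => (fun p : ({i : Fin K // i ≠ k} × Fin S) × Fin L =>
          crossLink (basis (u ω)) (channel fun e => X e ω) k j p.1 p.2) ∈ B k) fun s => by
          by_contra hcon
          push Not at hcon
          exact hωW k s hcon
      refine (sel k).pick_le (metric svd (fun k => U k ω) (fun k i j => H k i j ω) k) g hg hgn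
        fun s => ?_
      obtain ⟨y, hy1, hy2⟩ := hBy k _ (hgB s)
      exact metric_le_of_small svd _ _ k (g s) hy1 hy2
    · exact not_not.1 (hωZ i)
  have hone : 1 ≤ μ E + (ε + ε) := by
    calc (1 : ENNReal) = μ Set.univ := measure_univ.symm
      _ ≤ μ (E ∪ ((⋃ i, ⋃ s, W i s) ∪ ⋃ i, Z i)) := measure_mono hcover
      _ ≤ μ E + (μ (⋃ i, ⋃ s, W i s) + μ (⋃ i, Z i)) :=
        (measure_union_le _ _).trans (add_le_add le_rfl (measure_union_le _ _))
      _ ≤ μ E + (ε + ε) := by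
        gcongr
        · refine (measure_iUnion_fintype_le _ _).trans (le_trans ?_ hsnr1)
          exact Finset.sum_le_sum fun i _ => (measure_iUnion_fintype_le _ _).trans
            (Finset.sum_le_sum fun s _ => hW i s)
        · refine (measure_iUnion_fintype_le _ _).trans
            ((Finset.sum_le_sum fun i _ => hZ i).trans (le_of_eq ?_))
          rw [Finset.sum_const, Finset.card_univ, Fintype.card_fin, nsmul_eq_mul]
          exact ENNReal.mul_div_cancel (by exact_mod_cast hK.ne') (by simp)
  by_contra hle
  exact absurd (hone.trans (add_le_add (not_lt.1 hle) le_rfl)) (not_le.2 hε)
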